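/- Let $\lambda$ and $\kappa$ be regular cardinals with $\kappa$ uncountable and $\kappa^+<\lambda$. For a set $C$ of ordinals let $\operatorname{otp}(C)$ be its order type, $\operatorname{acc}(C)$ the set of limit ordinals $\alpha\in C$ with $\alpha=\sup(C\cap\alpha)$, and $\operatorname{nacc}(C)=C\setminus\operatorname{acc}(C)$; an ordinal is identified with the set of smaller ordinals. Then there are a stationary set $S\subseteq\{\delta<\lambda:\operatorname{cf}(\delta)=\kappa\}$ and a sequence $\langle\mathcal P_\alpha:\alpha<\lambda\rangle$ such that: (i) for every $\alpha<\lambda$, $\mathcal P_\alpha$ is a family of closed subsets of $\alpha$ (closed in the order topology of $\alpha$), and $|\mathcal P_\alpha|<\lambda$; (ii) $\operatorname{otp}(C)\le\kappa$ for every $C\in\bigcup_{\alpha<\lambda}\mathcal P_\alpha$; (iii) there is a club $E$ of $\lambda$ such that (a) $\mathcal P_\alpha=\emptyset$ for every $\alpha\in\lambda\setminus E$; (b) if $\alpha\in E$, then $\operatorname{otp}(C)\le\kappa$ for all $C\in\mathcal P_\alpha$; (c) if $\alpha\in E\setminus(S\cap\operatorname{acc}(E))$, then $\operatorname{otp}(C)<\kappa$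 for all $C\in\mathcal P_\alpha$; (d) if $\alpha\in S\cap\operatorname{acc}(E)$, then there is exactly one $C\in\mathcal P_\alpha$ with $\operatorname{otp}(C)=\kappa$; (e) if $\alpha\in S\cap\operatorname{acc}(E)$, $C\in\mathcal P_\alpha$ and $\operatorname{otp}(C)=\kappa$, then $\alpha=\sup(C)$; (iv) if $\alpha<\lambda$, $C\in\mathcal P_\alpha$ and $\beta\in\operatorname{nacc}(C)$, then $\beta\cap C\in\mathcal P_\beta$; (v) for every club $E'$ of $\lambda$ there are $\delta\in S\cap E'$ and $C\in\mathcal P_\delta$ with $C\subseteq E'$ and $\operatorname{otp}(C)=\kappa$. -/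

import Mathlib

open Set Cardinal Ordinal Topology

universe u

namespace GuessingClubs

/-- The order type of a set of ordinals. (A set of ordinals of universe `u` lives in universe
`u + 1`, so this is compared with lifts of ordinals of universe `u`.) -/
noncomputable def otp (C : Set Ordinal.{u}) : Ordinal.{u + 1} :=
  Ordinal.type (α := C) (· < ·)

/-- The accumulation points `α ∈ C` of `C`, i.e. the limit ordinals `α ∈ C` with
`α = sup (C ∩ α)`. -/
def acc (C : Set Ordinal.{u}) : Set Ordinal.{u} :=
  {α ∈ C | AccPt α (Filter.principal C)}

/-- The non-accumulation points of `C`. -/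
def nacc (C : Set Ordinal.{u}) : Set Ordinal.{u} :=
  C \ acc C

/-- `C` is a subset of the ordinal `o` (identified with the set of smaller ordinals) that is
closed in `o`. -/
def IsClosedIn (C : Set Ordinal.{u}) (o : Ordinal.{u}) : Prop :=
  C ⊆ Iio o ∧ IsClosed (Subtype.val ⁻¹' C : Set (Iio o))

/-- `E` is a closed unbounded subset of the ordinal `o`. -/
def IsClubIn (E : Set Ordinal.{u}) (o : Ordinal.{u}) : Prop :=
  E ⊆ Iio o ∧ IsClub (Subtype.val ⁻¹' E : Set (Iio o))

/-- `S` is a stationary subset of the ordinal `o`. -/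
def IsStationaryIn (S : Set Ordinal.{u}) (o : Ordinal.{u}) : Prop :=
  S ⊆ Iio o ∧ IsStationary (Subtype.val ⁻¹' S : Set (Iio o))

/-- The property `⊕` of a sequence `⟨P α : α < lam⟩` (values of `P` at `α ≥ lam` play no role),
for a cardinal `lam`, an ordinal `d` and a set `S` of ordinals below `lam`. -/
structure IsGuessingSystem (lam : Cardinal.{u}) (d : Ordinal.{u}) (S : Set Ordinal.{u})
    (P : Ordinal.{u} → Set (Set Ordinal.{u})) : Prop where
  closed : ∀ α < lam.ord, ∀ C ∈ P α, IsClosedIn C α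
  card_lt : ∀ α < lam.ord, Cardinal.mk (P α) < Cardinal.lift.{u + 1} lam
  otp_le : ∀ α < lam.ord, ∀ C ∈ P α, otp C ≤ Ordinal.lift.{u + 1} d
  exists_club : ∃ E : Set Ordinal.{u}, IsClubIn E lam.ord ∧
    (∀ α < lam.ord, α ∉ E → P α = ∅) ∧
    (∀ α ∈ E, ∀ C ∈ P α, otp C ≤ Ordinal.lift.{u + 1} d) ∧
    (∀ α ∈ E \ (S ∩ acc E), ∀ C ∈ P α, otp C < Ordinal.lift.{u + 1} d) ∧
    (∀ α ∈ S ∩ acc E, ∃! C, C ∈ P α ∧ otp C = Ordinal.lift.{u + 1} d) ∧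
    (∀ α ∈ S ∩ acc E, ∀ C ∈ P α, otp C = Ordinal.lift.{u + 1} d → IsLUB C α)
  coherent : ∀ α < lam.ord, ∀ C ∈ P α, ∀ β ∈ nacc C, Iio β ∩ C ∈ P β
  guess : ∀ E' : Set Ordinal.{u}, IsClubIn E' lam.ord →
    ∃ δ ∈ S ∩ E', ∃ C ∈ P δ, C ⊆ E' ∧ otp C = Ordinal.lift.{u + 1} d

end GuessingClubs

/-! The proof combines club guessing with approachability.

Guessing. Let `S` be a stationary set of points of cofinality κ, each with a ladder `A δ` (closed,
cofinal, of type κ). For a club `E`, push every point of `A δ` down to the supremum of `E` below it.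
Some `E` makes these dropped ladders guess all clubs (`exists_club_drop_guess`). Otherwise every `E`
has a counterexample club. Iterate κ⁺ times, intersecting along the way; the stages remain clubs
because κ⁺ < λ. Fix `δ ∈ S` that is a limit of the final club. The drop of each of the κ points of
`A δ` is nonincreasing in the stage, hence eventually constant, and by regularity of κ⁺ one stage
works for all of them. From that stage to the next the dropped ladder does not change, so it lies in
the counterexample club, a contradiction.

Coherence. The family at `β` must contain the initial segments at `β` of all dropped ladders having
`β` as a non-accumulation point, yet have fewer than λ members. Such a segment is the drop of an
initial segment of the original ladder (`exists_eq_drop`), so it suffices that initial segments of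
the ladders at non-accumulation points come from small families `Q β`. `Approachable` asks for this
at stationarily many points of cofinality κ, and `S` consists of those points.

Approachability. If λ = κ⁺⁺, put μ = κ⁺: injections of the ordinals below μ⁺ into μ cohere well
enough to reconstruct ladders locally (`exists_approachable_succ`). If λ > κ⁺⁺, put θ = κ⁺⁺:
guessing ladders on θ are copied along a continuous θ-sequence in a given club that grows fast
enough to overtake the stages at which the segments are listed (`exists_approachable_of_between`).
-/

namespace GuessingClubs

/-! ### Limit points and clubs. -/

/-- `x` is a limit of elements of `A` below `x`. -/
def LimPt (A : Set Ordinal.{u}) (x : Ordinal.{u}) : Prop :=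
  x ≠ 0 ∧ ∀ y < x, ∃ a ∈ A, y < a ∧ a < x

theorem accPt_principal_iff_limPt {A : Set Ordinal.{u}} {x : Ordinal.{u}} :
    AccPt x (Filter.principal A) ↔ LimPt A x := by
  rw [SuccOrder.accPt_principal, LimPt]
  simp [Set.Nonempty]

theorem mem_acc_iff {A : Set Ordinal.{u}} {x : Ordinal.{u}} : x ∈ acc A ↔ x ∈ A ∧ LimPt A x := by
  simp [acc, accPt_principal_iff_limPt]

theorem mem_nacc_iff {A : Set Ordinal.{u}} {x : Ordinal.{u}} :
    x ∈ nacc A ↔ x ∈ A ∧ ¬ LimPt A x := by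
  simp only [nacc, mem_sdiff, mem_acc_iff]
  tauto

theorem LimPt.mono {A B : Set Ordinal.{u}} {x : Ordinal.{u}} (h : LimPt A x) (hAB : A ⊆ B) :
    LimPt B x :=
  ⟨h.1, fun y hy ↦ let ⟨a, ha, h⟩ := h.2 y hy; ⟨a, hAB ha, h⟩⟩

theorem isClosedIn_iff {C : Set Ordinal.{u}} {o : Ordinal.{u}} :
    IsClosedIn C o ↔ C ⊆ Iio o ∧ ∀ x < o, LimPt C x → x ∈ C := by
  simp [IsClosedIn, isClosed_iff_accPt, ← Filter.comap_principal,
    isOpen_Iio.isOpenEmbedding_subtypeVal.accPt_comap_iff, accPt_principal_iff_limPt]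

/-- A closed unbounded subset of a limit ordinal, in terms of limit points. -/
structure Club (o : Ordinal.{u}) (E : Set Ordinal.{u}) : Prop where
  lt : ∀ x ∈ E, x < o
  closed : ∀ x < o, LimPt E x → x ∈ E
  unbdd : ∀ x < o, ∃ y ∈ E, x < y

theorem isClubIn_iff {E : Set Ordinal.{u}} {o : Ordinal.{u}} (ho : Order.IsSuccLimit o) :
    IsClubIn E o ↔ Club o E := by
  constructor
  · rintro ⟨h1, h2⟩
    refine ⟨fun x hx ↦ h1 hx, fun x hx hl ↦ ?_, fun x hx ↦ ?_⟩
    · obtain ⟨a0, ha0, -, ha0x⟩ := hl.2 0 (pos_iff_ne_zero.2 hl.1)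
      refine h2.isLUB_mem (x := ⟨x, hx⟩) (t := {y | y.1 ∈ E ∧ y.1 < x}) (fun y hy ↦ hy.1)
        ⟨⟨a0, ha0x.trans hx⟩, ha0, ha0x⟩ ⟨fun y hy ↦ hy.2.le, fun b hb ↦ ?_⟩
      by_contra hbx
      obtain ⟨a, ha, hba, hax⟩ := hl.2 b.1 (not_le.1 hbx)
      exact (hb (a := ⟨a, hax.trans hx⟩) ⟨ha, hax⟩).not_gt hba
    · obtain ⟨y, hy, hxy⟩ := h2.isCofinal ⟨x + 1, ho.add_one_lt hx⟩
      exact ⟨y, hy, (lt_add_one x).trans_le hxy⟩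
  · intro h
    refine ⟨h.lt, ?_, fun x ↦ ?_⟩
    · intro s hs hs0 _ a ha
      by_contra haE
      have hlt : ∀ y ∈ s, y < a := fun y hy ↦ lt_of_le_of_ne (ha.1 hy) (by
        rintro rfl; exact haE (hs hy))
      refine haE (h.closed a.1 a.2 ⟨?_, fun y hy ↦ ?_⟩)
      · obtain ⟨y, hy⟩ := hs0
        exact (bot_lt_of_lt (show y.1 < a.1 from hlt y hy)).ne'
      · by_contra! hc
        have : a ≤ ⟨y, hy.trans a.2⟩ := ha.2 fun z hz ↦ by
          by_contra hzy
          exact (hc z.1 (hs hz) (not_le.1 hzy)).not_gt (hlt z hz)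
        exact hy.not_ge this
    · obtain ⟨y, hy, hxy⟩ := h.unbdd x.1 x.2
      exact ⟨⟨y, h.lt y hy⟩, hy, hxy.le⟩

theorem Club.iInter {lam : Cardinal.{u}} (hlam : lam.IsRegular) (hunc : ℵ₀ < lam)
    {ι : Type (u + 1)} {f : ι → Set Ordinal.{u}} (hι : #ι < Cardinal.lift.{u + 1} lam)
    (hf : ∀ i, Club lam.ord (f i)) : Club lam.ord {x | x < lam.ord ∧ ∀ i, x ∈ f i} := by
  have hl : Order.IsSuccLimit lam.ord := isSuccLimit_ord hlam.aleph0_le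
  rw [← isClubIn_iff hl]
  refine ⟨fun x hx ↦ hx.1, ?_⟩
  have hcof : Order.cof (Iio lam.ord) = Cardinal.lift.{u + 1} lam := by
    rw [Ordinal.cof_Iio, ← lift_cof, hlam.cof_ord]
  have := IsClub.iInter (α := Iio lam.ord) (f := fun i ↦ Subtype.val ⁻¹' f i)
    (by rw [hcof]; simpa using hunc.ne') (by rw [hcof]; simpa using hι)
    fun i ↦ ((isClubIn_iff hl).2 (hf i)).2
  convert this using 1
  ext x
  simpa using fun _ ↦ mem_Iio.1 x.2

theorem Club.insert_zero {o : Ordinal.{u}} (ho : 0 < o) {E : Set Ordinal.{u}} (hE : Club o E) :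
    Club o (insert 0 E) := by
  refine ⟨?_, fun x hx hl ↦ ?_, fun x hx ↦ ?_⟩
  · rintro x (rfl | hx)
    exacts [ho, hE.lt x hx]
  · refine Or.inr (hE.closed x hx ⟨hl.1, fun y hy ↦ ?_⟩)
    obtain ⟨a, ha | ha, hya⟩ := hl.2 y hy
    · subst ha
      exact absurd hya.1 not_lt_zero
    · exact ⟨a, ha, hya⟩
  · obtain ⟨y, hy, hxy⟩ := hE.unbdd x hx
    exact ⟨y, Or.inr hy, hxy⟩

/-- In an ordinal of uncountable cofinality, a relation with arbitrarily large witnesses can be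
closed off below some ordinal. -/
theorem exists_closed_under {o : Ordinal.{u}} (ho : ℵ₀ < o.cof)
    {R : Ordinal.{u} → Ordinal.{u} → Prop} (hR : ∀ x < o, ∃ y < o, x < y ∧ R x y)
    {x : Ordinal.{u}} (hx : x < o) :
    ∃ y < o, x < y ∧ ∀ z < y, ∃ v w, z < v ∧ v < w ∧ w < y ∧ R v w := by
  choose! f hfo hlt hfR using hR
  let g : ℕ → Ordinal.{u} := fun n ↦ f^[n] x
  have hg : ∀ n, g n < o := by
    intro n
    induction n with
    | zero => exact hx
    | succ n ih => simpa only [g, Function.iterate_succ_apply'] using hfo _ ih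
  have hgs : ∀ n, g (n + 1) = f (g n) := fun n ↦ Function.iterate_succ_apply' f n x
  have hgl : ∀ n, g n < g (n + 1) := fun n ↦ by rw [hgs]; exact hlt _ (hg n)
  have hmono : StrictMono g := strictMono_nat_of_lt_succ hgl
  have hbdd : BddAbove (range g) := ⟨o, by rintro _ ⟨n, rfl⟩; exact (hg n).le⟩
  have hle : ∀ n, g n < ⨆ n, g n := fun n ↦ (hgl n).trans_le (le_ciSup hbdd (n + 1))
  refine ⟨⨆ n, g n, ?_, hle 0, fun z hz ↦ ?_⟩
  · refine lift_iSup_lt_of_lt_cof ?_ hg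
    simpa [← lift_cof] using ho
  · obtain ⟨n, hn⟩ := exists_lt_of_lt_ciSup hz
    exact ⟨g n, g (n + 1), hn, hgl n, hle _, by rw [hgs]; exact hfR _ (hg n)⟩

/-- Iterating "next element of `E`" ω times stays below `o` by uncountable cofinality; the supremum
is the limit point. -/
theorem exists_limPt {o : Ordinal.{u}} (ho : ℵ₀ < o.cof) {E : Set Ordinal.{u}}
    (hlt : ∀ x ∈ E, x < o) (hE : ∀ x < o, ∃ y ∈ E, x < y) {x : Ordinal.{u}} (hx : x < o) :
    ∃ y < o, x < y ∧ LimPt E y := by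
  obtain ⟨y, hy, hxy, h⟩ := exists_closed_under ho (R := fun _ w ↦ w ∈ E)
    (fun x hx ↦ by obtain ⟨y, hy, hxy⟩ := hE x hx; exact ⟨y, hlt y hy, hxy, hy⟩) hx
  refine ⟨y, hy, hxy, (bot_lt_of_lt hxy).ne', fun z hz ↦ ?_⟩
  obtain ⟨v, w, hzv, hvw, hwy, hw⟩ := h z hz
  exact ⟨w, hw, hzv.trans hvw, hwy⟩

theorem limPt_limPt {o x : Ordinal.{u}} {E : Set Ordinal.{u}}
    (h : LimPt {x | x < o ∧ LimPt E x} x) : LimPt E x := by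
  refine ⟨h.1, fun y hy ↦ ?_⟩
  obtain ⟨a, ha, hya, hax⟩ := h.2 y hy
  obtain ⟨b, hb, hyb, hba⟩ := ha.2.2 y hya
  exact ⟨b, hb, hyb, hba.trans hax⟩

theorem Club.limPts {o : Ordinal.{u}} (ho : ℵ₀ < o.cof)
    {E : Set Ordinal.{u}} (hE : Club o E) : Club o {x | x < o ∧ LimPt E x} := by
  refine ⟨fun x hx ↦ hx.1, fun x hx hl ↦ ⟨hx, limPt_limPt hl⟩, fun x hx ↦ ?_⟩
  obtain ⟨y, hy, hxy, h⟩ := exists_limPt ho hE.lt hE.unbdd hx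
  exact ⟨y, ⟨hy, h⟩, hxy⟩

/-! ### Ladders and order types. -/

/-- A set of fewer than `cof o` ordinals below `o` has a strict bound below `o`. -/
theorem exists_bound {o : Ordinal.{u}} {X : Set Ordinal.{u}}
    (hX : #X < Cardinal.lift.{u + 1} o.cof) (h : ∀ x ∈ X, x < o) : ∃ β < o, ∀ x ∈ X, x < β := by
  refine ⟨_, sSup_add_one_lt_of_lt_cof (by rwa [← lift_cof]) h, fun x hx ↦ ?_⟩
  have hb : BddAbove ((· + 1) '' X) := by
    refine ⟨o, ?_⟩
    rintro _ ⟨y, hy, rfl⟩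
    exact Order.add_one_le_of_lt (h y hy)
  exact (lt_add_one x).trans_le (le_csSup hb ⟨x, hx, rfl⟩)

/-- `A` is a closed cofinal subset of `δ` whose order type is the regular cardinal `kap`,
expressed by smallness of its proper initial segments. -/
structure Ladder (kap : Cardinal.{u}) (δ : Ordinal.{u}) (A : Set Ordinal.{u}) : Prop where
  cof : δ.cof = kap
  lt : ∀ x ∈ A, x < δ
  unbdd : ∀ x < δ, ∃ y ∈ A, x < y
  closed : ∀ x < δ, LimPt A x → x ∈ A
  small : ∀ β < δ, #(A ∩ Iio β : Set Ordinal.{u}) < Cardinal.lift.{u + 1} kap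

theorem otp_le_ord {A : Set Ordinal.{u}} {c : Cardinal.{u + 1}}
    (h : ∀ x ∈ A, #(A ∩ Iio x : Set Ordinal.{u}) < c) : otp A ≤ c.ord := by
  refine le_of_forall_lt fun b hb ↦ ?_
  obtain ⟨⟨x, hx⟩, rfl⟩ := typein_surj _ hb
  rw [Cardinal.lt_ord, card_typein]
  refine lt_of_le_of_lt (mk_le_of_injective (β := (A ∩ Iio x : Set Ordinal.{u}))
    (f := fun y ↦ ⟨y.1.1, y.1.2, y.2⟩) fun y z hyz ↦ ?_) (h x hx)
  have hval : y.1.1 = z.1.1 := by simpa using Subtype.ext_iff.1 hyz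
  exact Subtype.ext (Subtype.ext hval)

theorem otp_lt_ord_iff {A : Set Ordinal.{u}} {c : Cardinal.{u + 1}} : otp A < c.ord ↔ #A < c := by
  rw [Cardinal.lt_ord, otp, card_type]

theorem Ladder.mk_ge {kap : Cardinal.{u}} {δ : Ordinal.{u}} {A : Set Ordinal.{u}}
    (h : Ladder kap δ A) : Cardinal.lift.{u + 1} kap ≤ #A := by
  by_contra! hlt
  rw [← h.cof] at hlt
  obtain ⟨β, hβ, hb⟩ := exists_bound hlt h.lt
  obtain ⟨y, hy, hy'⟩ := h.unbdd β hβ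
  exact (hb y hy).not_gt hy'

theorem Ladder.otp_eq {kap : Cardinal.{u}} {δ : Ordinal.{u}} {A : Set Ordinal.{u}}
    (h : Ladder kap δ A) : otp A = Ordinal.lift.{u + 1} kap.ord := by
  rw [Cardinal.lift_ord]
  refine le_antisymm (otp_le_ord fun x hx ↦ ?_) (not_lt.1 fun hlt ↦ ?_)
  · exact h.small x (h.lt x hx)
  · exact h.mk_ge.not_gt (otp_lt_ord_iff.1 hlt)

theorem Ladder.mk_eq {kap : Cardinal.{u}} {δ : Ordinal.{u}} {A : Set Ordinal.{u}}
    (h : Ladder kap δ A) : #A = Cardinal.lift.{u + 1} kap := by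
  rw [← Cardinal.card_ord (Cardinal.lift kap), ← Cardinal.lift_ord, ← h.otp_eq, otp, card_type]

theorem Ladder.isLUB {kap : Cardinal.{u}} {δ : Ordinal.{u}} {A : Set Ordinal.{u}}
    (h : Ladder kap δ A) : IsLUB A δ := by
  refine ⟨fun x hx ↦ (h.lt x hx).le, fun b hb ↦ ?_⟩
  by_contra! hlt
  obtain ⟨y, hy, hy'⟩ := h.unbdd b hlt
  exact (hb hy).not_gt hy'

/-- Take a cofinal `X ⊆ δ` of type κ. Its limit points below `δ` are closed automatically and
unbounded because κ is uncountable. -/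
theorem exists_ladder {kap : Cardinal.{u}} (hunc : ℵ₀ < kap) {δ : Ordinal.{u}}
    (hδ : δ.cof = kap) : ∃ A, Ladder kap δ A := by
  obtain ⟨s, hs, hst⟩ := exists_ord_cof_eq (Iio δ)
  have hlim : Order.IsSuccLimit δ := by
    rw [← one_lt_cof_iff, hδ]
    exact one_lt_aleph0.trans hunc
  rw [Ordinal.cof_Iio, ← lift_cof, hδ] at hst
  let X : Set Ordinal.{u} := Subtype.val '' s
  have hXlt : ∀ x ∈ X, x < δ := by
    rintro _ ⟨x, -, rfl⟩
    exact x.2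
  have hXub : ∀ x < δ, ∃ y ∈ X, x < y := by
    intro x hx
    obtain ⟨y, hy, hxy⟩ := hs ⟨x + 1, hlim.add_one_lt hx⟩
    exact ⟨y, ⟨y, hy, rfl⟩, (lt_add_one x).trans_le hxy⟩
  have hXsmall : ∀ x ∈ X, #(X ∩ Iio x : Set Ordinal.{u}) < Cardinal.lift.{u + 1} kap := by
    rintro _ ⟨x, hx, rfl⟩
    have := typein_lt_type (α := s) (· < ·) ⟨x, hx⟩
    rw [hst, Cardinal.lt_ord, card_typein] at this
    refine lt_of_le_of_lt ?_ this
    refine mk_le_of_surjective (f := fun y : {y : s // y < ⟨x, hx⟩} ↦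
      (⟨y.1.1.1, ⟨y.1.1, y.1.2, rfl⟩, y.2⟩ : (X ∩ Iio x.1 : Set Ordinal.{u}))) ?_
    rintro ⟨_, ⟨y, hy, rfl⟩, hyx⟩
    exact ⟨⟨⟨y, hy⟩, hyx⟩, rfl⟩
  refine ⟨{x | x < δ ∧ LimPt X x}, hδ, fun x hx ↦ hx.1, fun x hx ↦ ?_,
    fun x hx hl ↦ ⟨hx, limPt_limPt hl⟩, fun β hβ ↦ ?_⟩
  · obtain ⟨y, hy, hxy, h⟩ := exists_limPt (hδ ▸ hunc) hXlt hXub hx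
    exact ⟨y, ⟨hy, h⟩, hxy⟩
  · obtain ⟨b, hb, hβb⟩ := hXub β hβ
    -- `f x` is the next element of `X` after `x`. It is strictly increasing on limit points of `X`,
    -- so it injects an initial segment of the ladder into one of `X`.
    choose! f hfX hf hmin using fun x (hx : x < δ) ↦ show ∃ y ∈ X, x < y ∧ ∀ z ∈ X, x < z → y ≤ z by
      obtain ⟨y, hy, hxy⟩ := hXub x hx
      obtain ⟨m, hm, hmin⟩ := WellFounded.has_min (wellFounded_lt (α := Ordinal.{u}))
        {y | y ∈ X ∧ x < y} ⟨y, hy, hxy⟩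
      exact ⟨m, hm.1, hm.2, fun z hz hxz ↦ not_lt.1 (hmin z ⟨hz, hxz⟩)⟩
    obtain ⟨b', hb', hbb'⟩ := hXub b (hXlt b hb)
    refine lt_of_le_of_lt ?_ (hXsmall b' hb')
    have hinj : ∀ x y, x < δ → LimPt X y → x < y → y < δ → f x < f y := by
      intro x y hx hy hxy hyδ
      obtain ⟨a, ha, hxa, hay⟩ := hy.2 x hxy
      exact ((hmin x hx a ha hxa).trans_lt hay).trans (hf y hyδ)
    refine mk_le_of_injective (f := fun x : ({x | x < δ ∧ LimPt X x} ∩ Iio β : Set Ordinal.{u}) ↦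
      (⟨f x.1, hfX _ x.2.1.1,
        (hmin _ x.2.1.1 b hb (lt_trans x.2.2 hβb)).trans_lt hbb'⟩ :
        (X ∩ Iio b' : Set Ordinal.{u}))) ?_
    rintro ⟨x, ⟨hx, hlx⟩, hxβ⟩ ⟨y, ⟨hy, hly⟩, hyβ⟩ hxy
    replace hxy : f x = f y := Subtype.ext_iff.1 hxy
    refine Subtype.ext (?_ : x = y)
    rcases lt_trichotomy x y with h | h | h
    · exact absurd hxy (hinj x y hx hly h hy).ne
    · exact h
    · exact absurd hxy (hinj y x hy hlx h hx).ne'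

/-! ### Dropping a set into a club. -/

/-- The supremum of the elements of `E` below `α`. -/
noncomputable def below (E : Set Ordinal.{u}) (α : Ordinal.{u}) : Ordinal.{u} :=
  sSup (E ∩ Iio α)

theorem le_below {E : Set Ordinal.{u}} {x α : Ordinal.{u}} (hx : x ∈ E) (h : x < α) :
    x ≤ below E α :=
  le_csSup ⟨α, fun _ hy ↦ le_of_lt hy.2⟩ ⟨hx, h⟩

theorem below_le {E : Set Ordinal.{u}} {α : Ordinal.{u}} : below E α ≤ α :=
  csSup_le' fun _ hy ↦ le_of_lt hy.2

theorem exists_of_lt_below {E : Set Ordinal.{u}} {y α : Ordinal.{u}} (h : y < below E α) :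
    ∃ e ∈ E, y < e ∧ e < α := by
  by_contra! hc
  exact h.not_ge (csSup_le' fun e he ↦ not_lt.1 fun hye ↦ (hc e he.1 hye).not_gt he.2)

theorem below_mono {E : Set Ordinal.{u}} {α β : Ordinal.{u}} (h : α ≤ β) :
    below E α ≤ below E β :=
  csSup_le' fun _ he ↦ le_below he.1 (lt_of_lt_of_le he.2 h)

theorem below_anti {E F : Set Ordinal.{u}} (h : F ⊆ E) (α : Ordinal.{u}) :
    below F α ≤ below E α :=
  csSup_le' fun _ he ↦ le_below (h he.1) he.2

theorem below_eq_self {E : Set Ordinal.{u}} {α : Ordinal.{u}} (h : LimPt E α) :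
    below E α = α := by
  refine below_le.antisymm (not_lt.1 fun hlt ↦ ?_)
  obtain ⟨a, ha, hba, haα⟩ := h.2 _ hlt
  exact (le_below ha haα).not_gt hba

/-- The supremum is either attained or a limit of `E`; `0 ∈ E` covers the case where nothing of `E`
lies below `α`, the supremum then being 0. -/
theorem Club.below_mem {o : Ordinal.{u}} {E : Set Ordinal.{u}} (hE : Club o E) (h0 : 0 ∈ E)
    {α : Ordinal.{u}} (hα : α < o) : below E α ∈ E := by
  by_contra hn
  refine hn (hE.closed _ (below_le.trans_lt hα) ⟨fun h ↦ hn (h ▸ h0), fun y hy ↦ ?_⟩)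
  obtain ⟨e, he, hye, heα⟩ := exists_of_lt_below hy
  exact ⟨e, he, hye, (le_below he heα).lt_of_ne fun h ↦ hn (h ▸ he)⟩

/-- The result of pushing the elements of `A` down into `E`. -/
def drop (E A : Set Ordinal.{u}) : Set Ordinal.{u} :=
  below E '' A \ {0}

theorem Club.drop_subset {o : Ordinal.{u}} {E : Set Ordinal.{u}} (hE : Club o E) (h0 : 0 ∈ E)
    {A : Set Ordinal.{u}} (hA : ∀ x ∈ A, x < o) : drop E A ⊆ E := by
  rintro _ ⟨⟨x, hx, rfl⟩, -⟩
  exact hE.below_mem h0 (hA x hx)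

/-- A limit of dropped points is a limit both of `E` and of `A`, so it belongs to `A` and is fixed
by `below E`. Cofinality of the drop uses that `δ` is a limit of `E`. -/
theorem Ladder.drop {kap : Cardinal.{u}} {o δ : Ordinal.{u}} {A E : Set Ordinal.{u}}
    (hA : Ladder kap δ A) (hE : Club o E) (hδo : δ < o) (hδ : LimPt E δ) :
    Ladder kap δ (drop E A) := by
  refine ⟨hA.cof, ?_, fun x hx ↦ ?_, fun x hx hl ↦ ⟨?_, hl.1⟩, fun β hβ ↦ ?_⟩
  · rintro _ ⟨⟨x, hx, rfl⟩, -⟩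
    exact below_le.trans_lt (hA.lt x hx)
  · obtain ⟨e, he, hxe, heδ⟩ := hδ.2 x hx
    obtain ⟨a, ha, hea⟩ := hA.unbdd e heδ
    have := hxe.trans_le (le_below he hea)
    exact ⟨_, ⟨⟨a, ha, rfl⟩, (bot_lt_of_lt this).ne'⟩, this⟩
  · have hlE : LimPt E x := by
      refine ⟨hl.1, fun y hy ↦ ?_⟩
      obtain ⟨_, ⟨⟨a, ha, rfl⟩, -⟩, hya, hax⟩ := hl.2 y hy
      obtain ⟨e, he, hye, hea⟩ := exists_of_lt_below hya
      exact ⟨e, he, hye, (le_below he hea).trans_lt hax⟩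
    have hxE : x ∈ E := hE.closed x (hx.trans hδo) hlE
    refine ⟨x, hA.closed x hx ⟨hl.1, fun y hy ↦ ?_⟩, below_eq_self hlE⟩
    obtain ⟨_, ⟨⟨a, ha, rfl⟩, -⟩, hya, hax⟩ := hl.2 y hy
    refine ⟨a, ha, hya.trans_le below_le, ?_⟩
    rcases lt_trichotomy a x with h | h | h
    · exact h
    · rw [h, below_eq_self hlE] at hax
      exact absurd hax (lt_irrefl x)
    · exact absurd hax (le_below hxE h).not_gt
  · obtain ⟨e, he, hxe, heδ⟩ := hδ.2 β hβ
    obtain ⟨a, ha, hea⟩ := hA.unbdd e heδ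
    refine lt_of_le_of_lt ?_ (hA.small a (hA.lt a ha))
    refine (mk_le_mk_of_subset ?_).trans (mk_image_le (f := below E))
    rintro _ ⟨⟨⟨x, hx, rfl⟩, -⟩, hxβ⟩
    refine ⟨x, ⟨hx, mem_Iio.2 (not_le.1 fun hax ↦ ?_)⟩, rfl⟩
    exact (lt_trans hxβ hxe).not_ge (le_below he (hea.trans_le hax))

/-! ### Club guessing. -/

/-- The decreasing sequence of subsets of `o` obtained by iterating `F`, intersecting at each
stage over all the previous ones. -/
def iterInter (F : Set Ordinal.{u} → Set Ordinal.{u}) (o : Ordinal.{u}) (ζ : Ordinal.{u}) :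
    Set Ordinal.{u} :=
  {x | x < o ∧ ∀ ξ, (_ : ξ < ζ) → x ∈ F (iterInter F o ξ)}
termination_by ζ

theorem mem_iterInter {F : Set Ordinal.{u} → Set Ordinal.{u}} {o ζ x : Ordinal.{u}} :
    x ∈ iterInter F o ζ ↔ x < o ∧ ∀ ξ < ζ, x ∈ F (iterInter F o ξ) := by
  rw [iterInter]
  rfl

theorem iterInter_anti {F : Set Ordinal.{u} → Set Ordinal.{u}} {o ζ ξ : Ordinal.{u}}
    (h : ξ ≤ ζ) : iterInter F o ζ ⊆ iterInter F o ξ := fun x hx ↦ by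
  rw [mem_iterInter] at hx ⊢
  exact ⟨hx.1, fun η hη ↦ hx.2 η (hη.trans_le h)⟩

/-- Club guessing by dropping: some club `E` makes the dropped ladders guess all clubs. -/
theorem exists_club_drop_guess {lam kap : Cardinal.{u}} (hlam : lam.IsRegular)
    (hkap : ℵ₀ ≤ kap) (hlt : Order.succ kap < lam) {S : Set Ordinal.{u}}
    (hS : ∀ E, Club lam.ord E → ∃ δ ∈ S, δ ∈ E) {A : Ordinal.{u} → Set Ordinal.{u}}
    (hA : ∀ δ ∈ S, Ladder kap δ (A δ)) :
    ∃ E, Club lam.ord E ∧ 0 ∈ E ∧ ∀ E', Club lam.ord E' →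
      ∃ δ ∈ S, LimPt E δ ∧ δ ∈ E' ∧ drop E (A δ) ⊆ E' := by
  have hunc : ℵ₀ < lam := (hkap.trans (Order.le_succ kap)).trans_lt hlt
  have h0lam : 0 < lam.ord := hlam.ord_pos
  have hsucc : (Order.succ kap).IsRegular := isRegular_succ hkap
  by_contra! hcon
  choose! G hGclub hG using hcon
  -- Adding 0 keeps `below` inside every stage; `drop` discards 0, so the extra point never affects
  -- the contradiction.
  let F : Set Ordinal.{u} → Set Ordinal.{u} := fun X ↦ insert 0 (G X)
  let T := iterInter F lam.ord
  have hT : ∀ ζ ≤ (Order.succ kap).ord, Club lam.ord (T ζ) ∧ 0 ∈ T ζ := by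
    intro ζ
    induction ζ using WellFoundedLT.induction with
    | ind ζ ih =>
      intro hζ
      constructor
      · have := Club.iInter hlam hunc (ι := Iio ζ) (f := fun ξ ↦ F (T ξ.1)) ?_ fun ξ ↦ ?_
        · convert this using 1
          ext x
          simp only [T]
          rw [mem_iterInter]
          simp
        · rw [Cardinal.mk_Iio_ordinal, Cardinal.lift_lt]
          refine lt_of_le_of_lt ?_ hlt
          simpa using card_le_card hζ
        · obtain ⟨h1, h2⟩ := ih ξ.1 ξ.2 (ξ.2.le.trans hζ)
          exact (hGclub _ h1 h2).insert_zero h0lam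
      · simp only [T]
        rw [mem_iterInter]
        exact ⟨h0lam, fun ξ _ ↦ Or.inl rfl⟩
  obtain ⟨hTc, hT0⟩ := hT _ le_rfl
  obtain ⟨δ, hδS, hδlam, hδ⟩ := hS _ (hTc.limPts (by rwa [hlam.cof_ord]))
  have hAδ := hA δ hδS
  -- The stages decrease, so `below (T ζ) α` is nonincreasing in `ζ` and is constant from a stage
  -- attaining its minimum.
  have hst : ∀ α, ∃ ζ < (Order.succ kap).ord, ∀ ζ' < (Order.succ kap).ord,
      below (T ζ) α ≤ below (T ζ') α := by
    intro α
    obtain ⟨m, ⟨ζ, hζ, rfl⟩, hm⟩ := WellFounded.has_min (wellFounded_lt (α := Ordinal.{u}))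
      ((fun ζ ↦ below (T ζ) α) '' Iio (Order.succ kap).ord) ⟨_, 0, hsucc.ord_pos, rfl⟩
    exact ⟨ζ, hζ, fun ζ' hζ' ↦ not_lt.1 (hm _ ⟨ζ', hζ', rfl⟩)⟩
  choose z hz hzmin using hst
  -- Only κ points of the ladder have to stabilize and κ⁺ is regular, so one `ζ` serves all of them.
  obtain ⟨ζ, hζ, hζb⟩ := exists_bound (o := (Order.succ kap).ord) (X := z '' A δ)
    (by
      rw [hsucc.cof_ord]
      refine mk_image_le.trans_lt ?_
      rw [hAδ.mk_eq, Cardinal.lift_lt]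
      exact Order.lt_succ kap)
    (by rintro _ ⟨α, -, rfl⟩; exact hz α)
  have hζ1 : ζ + 1 < (Order.succ kap).ord :=
    (isSuccLimit_ord hsucc.aleph0_le).add_one_lt hζ
  obtain ⟨hTζ, h0ζ⟩ := hT ζ hζ.le
  obtain ⟨hTζ1, h0ζ1⟩ := hT (ζ + 1) hζ1.le
  have hsub : T (ζ + 1) ⊆ F (T ζ) := fun x hx ↦ by
    simp only [T] at hx
    rw [mem_iterInter] at hx
    exact hx.2 ζ (lt_add_one ζ)
  have hδT : ∀ ζ < (Order.succ kap).ord, LimPt (T ζ) δ :=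
    fun ζ hζ ↦ hδ.mono (iterInter_anti hζ.le)
  have hδG : δ ∈ G (T ζ) :=
    (hsub (hTζ1.closed δ hδlam (hδT _ hζ1))).resolve_left hδ.1
  refine hG (T ζ) hTζ h0ζ δ hδS (hδT ζ hζ) hδG ?_
  rintro _ ⟨⟨α, hα, rfl⟩, hne⟩
  have heq : below (T ζ) α = below (T (ζ + 1)) α := by
    refine le_antisymm ?_ (below_anti (iterInter_anti (lt_add_one ζ).le) α)
    exact (below_anti (iterInter_anti (hζb _ ⟨α, hα, rfl⟩).le) α).trans (hzmin α _ hζ1)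
  refine (hsub ?_).resolve_left hne
  rw [heq]
  exact hTζ1.below_mem h0ζ1 ((hAδ.lt α hα).trans hδlam)

/-! ### From approachability to a guessing system. -/

/-- The points of cofinality `kap` carrying a ladder whose initial segments at its
non-accumulation points are listed by the family `Q` are stationary. -/
structure Approachable (lam kap : Cardinal.{u}) (Q : Ordinal.{u} → Set (Set Ordinal.{u})) :
    Prop where
  card_lt : ∀ β < lam.ord, #(Q β) < Cardinal.lift.{u + 1} lam
  exists_ladder : ∀ E, Club lam.ord E → ∃ δ ∈ E, ∃ A, Ladder kap δ A ∧
    ∀ β ∈ nacc A, Iio β ∩ A ∈ Q β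

/-- An initial segment of a dropped ladder at a non-accumulation point is the drop of an initial
segment of the ladder at a non-accumulation point. -/
theorem exists_eq_drop {o β : Ordinal.{u}} {A E : Set Ordinal.{u}} (hE : Club o E) (h0 : 0 ∈ E)
    (hA : ∀ x ∈ A, x < o) (hβ : β ∈ nacc (drop E A)) :
    ∃ α ∈ nacc A, below E α = β ∧ Iio β ∩ drop E A = drop E (Iio α ∩ A) := by
  obtain ⟨⟨⟨α', hα', hα'β⟩, hβ0⟩, hβl⟩ := mem_nacc_iff.1 hβ
  -- Several points of `A` may drop to `β`. With the least one, all earlier points drop strictly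
  -- below `β`, which makes the two segments equal.
  obtain ⟨α, ⟨hα, rfl⟩, hmin⟩ := WellFounded.has_min (wellFounded_lt (α := Ordinal.{u}))
    {α | α ∈ A ∧ below E α = β} ⟨α', hα', hα'β⟩
  have hlt : ∀ a ∈ A, a < α → below E a < below E α := fun a ha haα ↦
    (below_mono haα.le).lt_of_ne fun h ↦ hmin a ⟨ha, h⟩ haα
  have hmem : below E α ∈ E := hE.below_mem h0 (hA α hα)
  refine ⟨α, mem_nacc_iff.2 ⟨hα, fun hl ↦ hβl ?_⟩, rfl, ?_⟩
  · have heq : below E α = α := by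
      refine below_le.antisymm (not_lt.1 fun h ↦ ?_)
      obtain ⟨a, ha, hba, haα⟩ := hl.2 _ h
      exact (hlt a ha haα).not_ge (le_below hmem hba)
    rw [heq]
    refine ⟨hl.1, fun y hy ↦ ?_⟩
    obtain ⟨e, he, hye, heα⟩ := exists_of_lt_below (heq.symm ▸ hy : y < below E α)
    obtain ⟨a, ha, hea, haα⟩ := hl.2 e heα
    have hya := hye.trans_le (le_below he hea)
    exact ⟨_, ⟨⟨a, ha, rfl⟩, (bot_lt_of_lt hya).ne'⟩, hya, below_le.trans_lt haα⟩
  · ext x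
    constructor
    · rintro ⟨hx, ⟨a, ha, rfl⟩, hne⟩
      refine ⟨⟨a, ⟨mem_Iio.2 (not_le.1 fun h ↦ ?_), ha⟩, rfl⟩, hne⟩
      exact (mem_Iio.1 hx).not_ge (below_mono h)
    · rintro ⟨⟨a, ⟨haα, ha⟩, rfl⟩, hne⟩
      exact ⟨hlt a ha haα, ⟨a, ha, rfl⟩, hne⟩

theorem Approachable.exists_isGuessingSystem {lam kap : Cardinal.{u}} (hlam : lam.IsRegular)
    (hkap : ℵ₀ ≤ kap) (hlt : Order.succ kap < lam) {Q : Ordinal.{u} → Set (Set Ordinal.{u})}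
    (hQ : Approachable lam kap Q) :
    ∃ S : Set Ordinal.{u}, IsStationaryIn S lam.ord ∧ (∀ δ ∈ S, δ.cof = kap) ∧
      ∃ P : Ordinal.{u} → Set (Set Ordinal.{u}), IsGuessingSystem lam kap.ord S P := by
  have hlim : Order.IsSuccLimit lam.ord := isSuccLimit_ord hlam.aleph0_le
  let S : Set Ordinal.{u} := {δ | δ < lam.ord ∧ ∃ A, Ladder kap δ A ∧
    ∀ β ∈ nacc A, Iio β ∩ A ∈ Q β}
  choose! A hA hAQ using fun δ (hδ : δ ∈ S) ↦ hδ.2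
  have hS : ∀ E, Club lam.ord E → ∃ δ ∈ S, δ ∈ E := fun E hE ↦ by
    obtain ⟨δ, hδ, h⟩ := hQ.exists_ladder E hE
    exact ⟨δ, ⟨hE.lt δ hδ, h⟩, hδ⟩
  obtain ⟨E, hE, h0, hguess⟩ := exists_club_drop_guess hlam hkap hlt hS hA
  have hAlt : ∀ δ ∈ S, ∀ x ∈ A δ, x < lam.ord := fun δ hδ x hx ↦ ((hA δ hδ).lt x hx).trans hδ.1
  let D : Ordinal.{u} → Set Ordinal.{u} := fun δ ↦ drop E (A δ)
  have hD : ∀ δ ∈ S, LimPt E δ → Ladder kap δ (D δ) := fun δ hδ hl ↦ (hA δ hδ).drop hE hδ.1 hl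
  have hDE : ∀ δ ∈ S, D δ ⊆ E := fun δ hδ ↦ hE.drop_subset h0 (hAlt δ hδ)
  have hSacc : ∀ δ, δ ∈ S ∩ acc E ↔ δ ∈ S ∧ LimPt E δ := fun δ ↦ by
    rw [mem_inter_iff, mem_acc_iff]
    exact ⟨fun h ↦ ⟨h.1, h.2.2⟩, fun h ↦ ⟨h.1, hE.closed δ h.1.1 h.2, h.2⟩⟩
  -- The first kind of member is forced by coherence and has type below κ; the second is the full
  -- ladder, the only possible member of type κ.
  let P : Ordinal.{u} → Set (Set Ordinal.{u}) := fun β ↦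
    {C | (∃ δ ∈ S, LimPt E δ ∧ β ∈ nacc (D δ) ∧ C = Iio β ∩ D δ) ∨
      β ∈ S ∧ LimPt E β ∧ C = D β}
  have hsmall : ∀ δ ∈ S, LimPt E δ → ∀ β ∈ D δ,
      otp (Iio β ∩ D δ) < Ordinal.lift.{u + 1} kap.ord := fun δ hδ hl β hβ ↦ by
    rw [Cardinal.lift_ord, otp_lt_ord_iff, inter_comm]
    exact (hD δ hδ hl).small β ((hD δ hδ hl).lt β hβ)
  have hle : ∀ β, ∀ C ∈ P β, otp C ≤ Ordinal.lift.{u + 1} kap.ord := by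
    rintro β C (⟨δ, hδ, hl, hβ, rfl⟩ | ⟨hδ, hl, rfl⟩)
    · exact (hsmall δ hδ hl β hβ.1).le
    · exact (hD β hδ hl).otp_eq.le
  have heq : ∀ β, ∀ C ∈ P β, otp C = Ordinal.lift.{u + 1} kap.ord →
      β ∈ S ∧ LimPt E β ∧ C = D β := by
    rintro β C (⟨δ, hδ, hl, hβ, rfl⟩ | h) hC
    · exact absurd hC (hsmall δ hδ hl β hβ.1).ne
    · exact h
  refine ⟨S, ⟨fun x hx ↦ hx.1, fun t ht ↦ ?_⟩, fun δ hδ ↦ (hA δ hδ).cof, P, ?_⟩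
  · have ht' : IsClubIn (Subtype.val '' t) lam.ord := by
      refine ⟨by rintro _ ⟨x, -, rfl⟩; exact x.2, ?_⟩
      rwa [preimage_image_eq _ Subtype.val_injective]
    obtain ⟨_, hδ, ⟨x, hx, rfl⟩⟩ := hS _ ((isClubIn_iff hlim).1 ht')
    exact ⟨x, hδ, hx⟩
  refine ⟨?_, ?_, fun β _ ↦ hle β, ⟨E, (isClubIn_iff hlim).2 hE, ?_, fun β _ ↦ hle β,
    ?_, ?_, ?_⟩, ?_, ?_⟩
  · rintro β - C (⟨δ, hδ, hl, hβ, rfl⟩ | ⟨hδ, hl, rfl⟩)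
    · refine isClosedIn_iff.2 ⟨inter_subset_left, fun x hx hlx ↦ ⟨hx, ?_⟩⟩
      exact (hD δ hδ hl).closed x (hx.trans ((hD δ hδ hl).lt β hβ.1)) (hlx.mono inter_subset_right)
    · exact isClosedIn_iff.2 ⟨(hD β hδ hl).lt, (hD β hδ hl).closed⟩
  · intro β hβ
    -- A point `α` that drops to `β` satisfies `α ≤ e`, since otherwise `e ≤ below E α = β`. Hence
    -- only the families `Q α` with `α ≤ e` matter.
    obtain ⟨e, he, hβe⟩ := hE.unbdd β hβ
    have hreg : (Cardinal.lift.{u + 1} lam).IsRegular := hlam.lift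
    have hcard : #(⋃ α ∈ Iic e, drop E '' Q α) < Cardinal.lift.{u + 1} lam := by
      refine (card_biUnion_lt_iff_forall_of_isRegular hreg ?_).2 fun α hα ↦ ?_
      · rw [← Order.Iio_succ, Cardinal.mk_Iio_ordinal, Cardinal.lift_lt, ← Cardinal.lt_ord]
        exact hlim.succ_lt (hE.lt e he)
      · exact mk_image_le.trans_lt (hQ.card_lt α (lt_of_le_of_lt hα (hE.lt e he)))
    refine (mk_le_mk_of_subset (t := (⋃ α ∈ Iic e, drop E '' Q α) ∪ {D β}) ?_).trans_lt
      ((mk_union_le _ _).trans_lt (Cardinal.add_lt_of_lt hreg.aleph0_le hcard ?_))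
    · rintro C (⟨δ, hδ, hl, hβD, rfl⟩ | ⟨-, -, rfl⟩)
      · obtain ⟨α, hα, hαβ, heqd⟩ := exists_eq_drop hE h0 (hAlt δ hδ) hβD
        refine Or.inl (mem_biUnion (x := α) ?_ ⟨Iio α ∩ A δ, hAQ δ hδ α hα, heqd.symm⟩)
        exact not_lt.1 fun h ↦ hβe.not_ge (hαβ ▸ le_below he h)
      · exact Or.inr rfl
    · rw [mk_singleton]
      exact one_lt_aleph0.trans_le hreg.aleph0_le
  · intro β hβ hβE
    rw [eq_empty_iff_forall_notMem]
    rintro C (⟨δ, hδ, hl, hβD, rfl⟩ | ⟨hδ, hl, rfl⟩)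
    · exact hβE (hDE δ hδ hβD.1)
    · exact hβE (hE.closed β hβ hl)
  · intro β hβ C hC
    refine (hle β C hC).lt_of_ne fun h ↦ hβ.2 ((hSacc β).2 ?_)
    obtain ⟨h1, h2, -⟩ := heq β C hC h
    exact ⟨h1, h2⟩
  · intro β hβ
    obtain ⟨h1, h2⟩ := (hSacc β).1 hβ
    exact ⟨D β, ⟨Or.inr ⟨h1, h2, rfl⟩, (hD β h1 h2).otp_eq⟩, fun C hC ↦ (heq β C hC.1 hC.2).2.2⟩
  · intro β _ C hC hotp
    obtain ⟨h1, h2, rfl⟩ := heq β C hC hotp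
    exact (hD β h1 h2).isLUB
  · rintro α - C (⟨δ, hδ, hl, hαD, rfl⟩ | ⟨hδ, hl, rfl⟩) β hβ
    · obtain ⟨⟨hβα, hβD⟩, hn⟩ := mem_nacc_iff.1 hβ
      refine Or.inl ⟨δ, hδ, hl, mem_nacc_iff.2 ⟨hβD, fun hlb ↦ hn ⟨hlb.1, fun y hy ↦ ?_⟩⟩, ?_⟩
      · obtain ⟨a, ha, hya, haβ⟩ := hlb.2 y hy
        exact ⟨a, ⟨haβ.trans hβα, ha⟩, hya, haβ⟩
      · rw [← inter_assoc, Iio_inter_Iio, inf_eq_left.2 (le_of_lt (mem_Iio.1 hβα))]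
    · exact Or.inl ⟨α, hδ, hl, hβ, rfl⟩
  · intro E' hE'
    obtain ⟨δ, hδ, hl, hδE', hsub⟩ := hguess E' ((isClubIn_iff hlim).1 hE')
    exact ⟨δ, ⟨hδ, hδE'⟩, D δ, Or.inr ⟨hδ, hl, rfl⟩, hsub, (hD δ hδ hl).otp_eq⟩

/-! ### Transitive collapse and pulling ladders back. -/

/-- The order type of the set of elements of `x` below `γ`, defined by recursion. -/
noncomputable def collapse (x : Set Ordinal.{u}) (γ : Ordinal.{u}) : Ordinal.{u} :=
  ⨆ y : {y : Iio γ // y.1 ∈ x}, collapse x y.1.1 + 1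
termination_by γ
decreasing_by exact y.1.2

theorem collapse_lt {x : Set Ordinal.{u}} {y γ : Ordinal.{u}} (hy : y ∈ x) (h : y < γ) :
    collapse x y < collapse x γ := by
  conv_rhs => rw [collapse]
  exact (lt_add_one _).trans_le (le_ciSup (f := fun y : {y : Iio γ // y.1 ∈ x} ↦
    collapse x y.1.1 + 1) bddAbove_of_small ⟨⟨y, h⟩, hy⟩)

theorem collapse_le {x : Set Ordinal.{u}} {γ o : Ordinal.{u}}
    (h : ∀ y ∈ x, y < γ → collapse x y < o) : collapse x γ ≤ o := by
  rw [collapse]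
  exact ciSup_le' fun y ↦ Order.add_one_le_of_lt (h _ y.2 y.1.2)

theorem exists_of_lt_collapse {x : Set Ordinal.{u}} {γ o : Ordinal.{u}} (h : o < collapse x γ) :
    ∃ y ∈ x, y < γ ∧ o ≤ collapse x y := by
  by_contra! hc
  exact h.not_ge (collapse_le hc)

theorem collapse_mono {x : Set Ordinal.{u}} {γ γ' : Ordinal.{u}} (h : γ ≤ γ') :
    collapse x γ ≤ collapse x γ' :=
  collapse_le fun _ hy hlt ↦ collapse_lt hy (hlt.trans_le h)

theorem exists_collapse_eq {x : Set Ordinal.{u}} {γ o : Ordinal.{u}} (h : o < collapse x γ) :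
    ∃ y ∈ x, y < γ ∧ collapse x y = o := by
  induction γ using WellFoundedLT.induction with
  | ind γ ih =>
    obtain ⟨y, hy, hyγ, hoy⟩ := exists_of_lt_collapse h
    rcases hoy.eq_or_lt with heq | hlt
    · exact ⟨y, hy, hyγ, heq.symm⟩
    · obtain ⟨z, hz, hzy, hzo⟩ := ih y hyγ hlt
      exact ⟨z, hz, hzy.trans hyγ, hzo⟩

theorem collapse_congr {x x' : Set Ordinal.{u}} {γ : Ordinal.{u}}
    (h : ∀ y < γ, y ∈ x ↔ y ∈ x') : collapse x γ = collapse x' γ := by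
  induction γ using WellFoundedLT.induction with
  | ind γ ih =>
    refine le_antisymm (collapse_le fun y hy hyγ ↦ ?_) (collapse_le fun y hy hyγ ↦ ?_)
    · rw [ih y hyγ fun z hz ↦ h z (hz.trans hyγ)]
      exact collapse_lt ((h y hyγ).1 hy) hyγ
    · rw [← ih y hyγ fun z hz ↦ h z (hz.trans hyγ)]
      exact collapse_lt ((h y hyγ).2 hy) hyγ

theorem lift_card_collapse_le (x : Set Ordinal.{u}) (γ : Ordinal.{u}) :
    Cardinal.lift.{u + 1} (collapse x γ).card ≤ #(x ∩ Iio γ : Set Ordinal.{u}) := by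
  rw [← Cardinal.mk_Iio_ordinal]
  refine (mk_le_mk_of_subset (t := collapse x '' (x ∩ Iio γ)) fun o ho ↦ ?_).trans mk_image_le
  obtain ⟨y, hy, hyγ, rfl⟩ := exists_collapse_eq ho
  exact ⟨y, ⟨hy, hyγ⟩, rfl⟩

theorem collapse_lt_ord {x : Set Ordinal.{u}} {γ : Ordinal.{u}} {c : Cardinal.{u}}
    (h : #(x ∩ Iio γ : Set Ordinal.{u}) < Cardinal.lift.{u + 1} c) : collapse x γ < c.ord := by
  rw [Cardinal.lt_ord, ← Cardinal.lift_lt.{u, u + 1}]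
  exact (lift_card_collapse_le x γ).trans_lt h

/-- The least ordinals whose collapse along `x` is a given element of `c`. -/
def pullback (x c : Set Ordinal.{u}) : Set Ordinal.{u} :=
  {γ | collapse x γ ∈ c ∧ ∀ γ' < γ, collapse x γ' < collapse x γ}

/-- `collapse x γ` sees only elements strictly below `γ`, so agreement strictly below `b` controls
the pullback up to and including `b`. -/
theorem pullback_inter_congr {x x' c : Set Ordinal.{u}} {b : Ordinal.{u}}
    (h : ∀ y < b, y ∈ x ↔ y ∈ x') : pullback x c ∩ Iic b = pullback x' c ∩ Iic b := by
  have key : ∀ γ ≤ b, collapse x γ = collapse x' γ := fun γ hγ ↦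
    collapse_congr fun y hy ↦ h y (hy.trans_le hγ)
  ext γ
  refine and_congr_left fun hγ ↦ ?_
  have hγ' : γ ≤ b := hγ
  simp only [pullback, mem_ofPred_eq, key γ hγ']
  refine and_congr_right fun _ ↦ forall₂_congr fun γ' hlt ↦ ?_
  rw [key γ' (hlt.le.trans hγ')]

theorem exists_pullback {x c : Set Ordinal.{u}} {γ o : Ordinal.{u}} (ho : o ∈ c)
    (h : o < collapse x γ) : ∃ β ∈ pullback x c, β < γ ∧ collapse x β = o := by
  obtain ⟨y, -, hyγ, hyo⟩ := exists_collapse_eq h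
  obtain ⟨β, rfl, hmin⟩ := WellFounded.has_min (wellFounded_lt (α := Ordinal.{u}))
    {β | collapse x β = o} ⟨y, hyo⟩
  refine ⟨β, ⟨ho, fun γ' hγ' ↦ (collapse_mono hγ'.le).lt_of_ne fun h ↦ hmin γ' h hγ'⟩, ?_, rfl⟩
  exact not_le.1 fun hle ↦ h.not_ge (collapse_mono hle)

/-- The set `x` embeds cofinally in `δ` and, via the collapse, in `collapse x δ`. -/
theorem cof_collapse {x : Set Ordinal.{u}} {δ : Ordinal.{u}} (hlt : ∀ y ∈ x, y < δ)
    (hub : ∀ y < δ, ∃ z ∈ x, y < z) : (collapse x δ).cof = δ.cof := by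
  have h1 := Order.cof_congr_of_strictMono (α := x) (γ := Iio δ)
    (f := fun y ↦ ⟨y.1, hlt _ y.2⟩) (fun _ _ h ↦ h) fun y ↦ by
      obtain ⟨z, hz, hyz⟩ := hub y.1 y.2
      exact ⟨_, ⟨⟨z, hz⟩, rfl⟩, hyz.le⟩
  have h2 := Order.cof_congr_of_strictMono (α := x) (γ := Iio (collapse x δ))
    (f := fun y ↦ ⟨collapse x y.1, collapse_lt y.2 (hlt _ y.2)⟩)
    (fun y z h ↦ collapse_lt y.2 h) fun o ↦ by
      obtain ⟨z, hz, -, hoz⟩ := exists_of_lt_collapse o.2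
      exact ⟨_, ⟨⟨z, hz⟩, rfl⟩, hoz⟩
  rwa [h1, Ordinal.cof_Iio, Ordinal.cof_Iio, ← lift_cof, ← lift_cof, Cardinal.lift_inj,
    eq_comm] at h2

/-- A ladder in the collapse of a cofinal set pulls back to a ladder. -/
theorem Ladder.pullback {kap : Cardinal.{u}} {δ : Ordinal.{u}} {x c : Set Ordinal.{u}}
    (hδ : δ.cof = kap) (hub : ∀ y < δ, ∃ z ∈ x, y < z ∧ z < δ)
    (hc : Ladder kap (collapse x δ) c) : Ladder kap δ (pullback x c) := by
  have hlt : ∀ γ ∈ GuessingClubs.pullback x c, γ < δ := fun γ hγ ↦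
    not_le.1 fun hle ↦ (hc.lt _ hγ.1).not_ge (collapse_mono hle)
  refine ⟨hδ, hlt, fun y hy ↦ ?_, fun γ hγ hl ↦ ⟨?_, fun γ' hγ' ↦ ?_⟩, fun β hβ ↦ ?_⟩
  · obtain ⟨z, hz, hyz, hzδ⟩ := hub y hy
    obtain ⟨o, ho, hzo⟩ := hc.unbdd _ (collapse_lt hz hzδ)
    obtain ⟨β, hβ, -, rfl⟩ := exists_pullback (x := x) ho (hc.lt o ho)
    exact ⟨β, hβ, hyz.trans (not_le.1 fun hle ↦ hzo.not_ge (collapse_mono hle))⟩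
  · obtain ⟨z, hz, hγz, hzδ⟩ := hub γ hγ
    refine hc.closed _ ((collapse_mono hγz.le).trans_lt (collapse_lt hz hzδ)) ⟨?_, fun o ho ↦ ?_⟩
    · obtain ⟨a, ha, h0a, haγ⟩ := hl.2 0 (pos_iff_ne_zero.2 hl.1)
      exact (bot_lt_of_lt ((ha.2 0 h0a).trans_le (collapse_mono haγ.le))).ne'
    · obtain ⟨y, hy, hyγ, hoy⟩ := exists_of_lt_collapse ho
      obtain ⟨a, ha, hya, haγ⟩ := hl.2 y hyγ
      obtain ⟨b, hb, hab, hbγ⟩ := hl.2 a haγ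
      exact ⟨_, ha.1, hoy.trans_lt (collapse_lt hy hya),
        (hb.2 a hab).trans_le (collapse_mono hbγ.le)⟩
  · obtain ⟨a, ha, hya, haγ⟩ := hl.2 γ' hγ'
    exact (ha.2 γ' hya).trans_le (collapse_mono haγ.le)
  · obtain ⟨w, hw, hβw, hwδ⟩ := hub β hβ
    obtain ⟨z, hz, hwz, hzδ⟩ := hub w hwδ
    refine lt_of_le_of_lt ?_ (hc.small _ (collapse_lt hz hzδ))
    refine mk_le_of_injective (f := fun γ : (GuessingClubs.pullback x c ∩ Iio β : Set Ordinal) ↦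
      (⟨collapse x γ.1, γ.2.1.1, ?_⟩ : (c ∩ Iio (collapse x z) : Set Ordinal))) ?_
    · exact (collapse_mono ((le_of_lt γ.2.2).trans hβw.le)).trans_lt (collapse_lt hw hwz)
    · rintro ⟨γ, hγ, hγβ⟩ ⟨γ', hγ', hγβ'⟩ h
      replace h : collapse x γ = collapse x γ' := Subtype.ext_iff.1 h
      refine Subtype.ext (?_ : γ = γ')
      rcases lt_trichotomy γ γ' with h' | h' | h'
      · exact absurd h (hγ'.2 γ h').ne
      · exact h'
      · exact absurd h (hγ.2 γ' h').ne'

/-! ### Continuous sequences in a club. -/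

/-- The sequence of least elements of `E` that exceed all previous values as well as the values of
the functional `G` at the previous initial segments. -/
noncomputable def leastSeq (E : Set Ordinal.{u})
    (G : Ordinal.{u} → (Ordinal.{u} → Ordinal.{u}) → Ordinal.{u}) (i : Ordinal.{u}) :
    Ordinal.{u} :=
  -- The truncation of the argument of `G k` at `k` makes the recursion well founded. The default 0
  -- is harmless when `G k s` depends only on `s` up to `k`.
  sInf {x | x ∈ E ∧ ∀ k, (_ : k < i) → leastSeq E G k < x ∧
    G k (fun m ↦ open Classical in if _ : m ≤ k then leastSeq E G m else 0) ≤ x}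
termination_by i
decreasing_by
  · assumption
  · exact lt_of_le_of_lt ‹_› ‹_›

/-- A club contains a continuous increasing sequence which grows as fast as prescribed. -/
theorem exists_continuous_seq {lam : Cardinal.{u}} (hlam : lam.IsRegular)
    {E : Set Ordinal.{u}} (hE : Club lam.ord E)
    (G : Ordinal.{u} → (Ordinal.{u} → Ordinal.{u}) → Ordinal.{u}) (hG : ∀ k s, G k s < lam.ord)
    (hGc : ∀ k s s', (∀ m ≤ k, s m = s' m) → G k s = G k s') :
    ∃ ξ : Ordinal.{u} → Ordinal.{u}, (∀ i < lam.ord, ξ i ∈ E) ∧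
      (∀ i < lam.ord, ∀ k < i, ξ k < ξ i ∧ G k ξ ≤ ξ i) ∧
      ∀ i < lam.ord, Order.IsSuccLimit i → ∀ y < ξ i, ∃ k < i, y < ξ k := by
  let ξ := leastSeq E G
  have hlim : Order.IsSuccLimit lam.ord := isSuccLimit_ord hlam.aleph0_le
  have hξ : ∀ i, ξ i = sInf {x | x ∈ E ∧ ∀ k < i, ξ k < x ∧ G k ξ ≤ x} := by
    intro i
    simp only [ξ]
    rw [leastSeq]
    congr! 8 with x k hk
    refine hGc _ _ _ fun m hm ↦ ?_
    simp [hm]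
  have hmem : ∀ i < lam.ord, ξ i ∈ E ∧ ∀ k < i, ξ k < ξ i ∧ G k ξ ≤ ξ i := by
    intro i
    induction i using WellFoundedLT.induction with
    | ind i ih =>
      intro hi
      have hne : {x | x ∈ E ∧ ∀ k < i, ξ k < x ∧ G k ξ ≤ x}.Nonempty := by
        obtain ⟨β, hβ, hb⟩ := exists_bound (o := lam.ord)
          (X := (fun k ↦ max (ξ k) (G k ξ)) '' Iio i) (by
            refine mk_image_le.trans_lt ?_
            rw [hlam.cof_ord, Cardinal.mk_Iio_ordinal, Cardinal.lift_lt]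
            exact Cardinal.lt_ord.1 hi) (by
            rintro _ ⟨k, hk, rfl⟩
            exact max_lt (hE.lt _ (ih k hk (lt_trans hk hi)).1) (hG _ _))
        obtain ⟨x, hx, hβx⟩ := hE.unbdd β hβ
        refine ⟨x, hx, fun k hk ↦ ?_⟩
        have := (hb _ ⟨k, hk, rfl⟩).trans hβx
        exact ⟨(le_max_left _ _).trans_lt this, ((le_max_right _ _).trans_lt this).le⟩
      have := csInf_mem hne
      rwa [← hξ i] at this
  refine ⟨ξ, fun i hi ↦ (hmem i hi).1, fun i hi ↦ (hmem i hi).2, fun i hi hil y hy ↦ ?_⟩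
  by_contra! hc
  have hbdd : BddAbove (ξ '' Iio i) := ⟨y, by rintro _ ⟨k, hk, rfl⟩; exact hc k hk⟩
  let s := sSup (ξ '' Iio i)
  have hsy : s ≤ y := csSup_le' (by rintro _ ⟨k, hk, rfl⟩; exact hc k hk)
  have hlt : ∀ k < i, ξ k < s := fun k hk ↦
    ((hmem (k + 1) ((hil.add_one_lt hk).trans hi)).2 k (lt_add_one k)).1.trans_le
      (le_csSup hbdd ⟨k + 1, hil.add_one_lt hk, rfl⟩)
  -- At a limit index the supremum `s` of the earlier values already meets every requirement, so the
  -- least choice `ξ i` cannot exceed it.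
  have hsE : s ∈ E := by
    refine hE.closed s (hsy.trans_lt (hy.trans (hE.lt _ (hmem i hi).1))) ⟨?_, fun z hz ↦ ?_⟩
    · exact (bot_lt_of_lt (hlt 0 hil.bot_lt)).ne'
    · obtain ⟨_, ⟨k, hk, rfl⟩, hzk⟩ := exists_lt_of_lt_csSup
        (Set.Nonempty.image ξ ⟨0, hil.bot_lt⟩) hz
      exact ⟨ξ k, (hmem k (lt_trans hk hi)).1, hzk, hlt k hk⟩
  refine (hsy.trans_lt hy).not_ge ?_
  rw [hξ i]
  refine csInf_le' ⟨hsE, fun k hk ↦ ⟨hlt k hk, ?_⟩⟩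
  exact ((hmem (k + 1) ((hil.add_one_lt hk).trans hi)).2 k (lt_add_one k)).2.trans
    (hlt _ (hil.add_one_lt hk)).le

theorem cof_apply_of_continuous {ξ : Ordinal.{u} → Ordinal.{u}} {i : Ordinal.{u}}
    (hmono : ∀ j < i, ∀ k < j, ξ k < ξ j) (hlt : ∀ k < i, ξ k < ξ i)
    (hcont : ∀ y < ξ i, ∃ k < i, y < ξ k) : (ξ i).cof = i.cof := by
  have h := Order.cof_congr_of_strictMono (α := Iio i) (γ := Iio (ξ i))
    (f := fun k ↦ ⟨ξ k.1, hlt _ k.2⟩) (fun k j h ↦ hmono j.1 j.2 k.1 h) fun y ↦ by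
      obtain ⟨k, hk, hyk⟩ := hcont y.1 y.2
      exact ⟨_, ⟨⟨k, hk⟩, rfl⟩, hyk.le⟩
  rwa [Ordinal.cof_Iio, Ordinal.cof_Iio, ← lift_cof, ← lift_cof, Cardinal.lift_inj,
    eq_comm] at h

/-- The ordinals of cofinality `kap` are stationary in `lam`. -/
theorem Club.exists_cof_eq {lam kap : Cardinal.{u}} (hlam : lam.IsRegular) (hkap : kap.IsRegular)
    (hlt : kap < lam) {E : Set Ordinal.{u}} (hE : Club lam.ord E) : ∃ δ ∈ E, δ.cof = kap := by
  obtain ⟨ξ, hξE, hξ, hcont⟩ := exists_continuous_seq hlam hE (fun _ _ ↦ 0)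
    (fun _ _ ↦ hlam.ord_pos) fun _ _ _ _ ↦ rfl
  have hk : kap.ord < lam.ord := ord_lt_ord.2 hlt
  refine ⟨ξ kap.ord, hξE _ hk, ?_⟩
  rw [cof_apply_of_continuous (fun j hj k hkj ↦ (hξ j (hj.trans hk) k hkj).1)
    (fun k h ↦ (hξ _ hk k h).1) (hcont _ hk (isSuccLimit_ord hkap.aleph0_le)), hkap.cof_ord]

/-! ### Approachability below the successor of a regular cardinal. -/

theorem mk_image3_lt {α β γ δ : Type u} {c : Cardinal.{u}} (hc : ℵ₀ ≤ c) {X : Set α} {Y : Set β}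
    {Z : Set γ} (hX : #X < c) (hY : #Y < c) (hZ : #Z < c) (f : α → β → γ → δ) :
    #{d | ∃ x ∈ X, ∃ y ∈ Y, ∃ z ∈ Z, d = f x y z} < c := by
  refine lt_of_le_of_lt ?_ (mul_lt_of_lt hc hX (mul_lt_of_lt hc hY hZ))
  rw [mul_def, mul_def]
  refine mk_le_of_surjective (f := fun p : X × Y × Z ↦
    (⟨f p.1 p.2.1 p.2.2, _, p.1.2, _, p.2.1.2, _, p.2.2.2, rfl⟩ :
      {d | ∃ x ∈ X, ∃ y ∈ Y, ∃ z ∈ Z, d = f x y z})) ?_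
  rintro ⟨_, x, hx, y, hy, z, hz, rfl⟩
  exact ⟨⟨⟨x, hx⟩, ⟨y, hy⟩, ⟨z, hz⟩⟩, rfl⟩

/-- The piece at level `i` of the filtration of `β` given by the function `g β`. -/
def piece (g : Ordinal.{u} → Ordinal.{u} → Ordinal.{u}) (β i : Ordinal.{u}) : Set Ordinal.{u} :=
  {α | α < β ∧ g β α < i}

theorem mk_piece_lt {mu : Cardinal.{u}} {g : Ordinal.{u} → Ordinal.{u} → Ordinal.{u}}
    {β i : Ordinal.{u}} (hinj : InjOn (g β) (Iio β)) (hi : i < mu.ord) :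
    #(piece g β i) < Cardinal.lift.{u + 1} mu := by
  have hi' : #(Iio i) < Cardinal.lift.{u + 1} mu := by
    rw [Cardinal.mk_Iio_ordinal, Cardinal.lift_lt]
    exact Cardinal.lt_ord.1 hi
  refine lt_of_le_of_lt (mk_le_of_injective (f := fun x : piece g β i ↦
    (⟨g β x.1, x.2.2⟩ : Iio i)) fun x y hxy ↦ ?_) hi'
  exact Subtype.ext (hinj x.2.1 y.2.1 (Subtype.ext_iff.1 hxy))

theorem exists_filtration (mu : Cardinal.{u}) :
    ∃ g : Ordinal.{u} → Ordinal.{u} → Ordinal.{u}, ∀ β < (Order.succ mu).ord,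
      InjOn (g β) (Iio β) ∧ ∀ α < β, g β α < mu.ord := by
  suffices ∀ β < (Order.succ mu).ord, ∃ f : Ordinal.{u} → Ordinal.{u},
      InjOn f (Iio β) ∧ ∀ α < β, f α < mu.ord by
    choose! g hg using this
    exact ⟨g, hg⟩
  intro β hβ
  have hle : #(Iio β) ≤ #(Iio mu.ord) := by
    rw [Cardinal.mk_Iio_ordinal, Cardinal.mk_Iio_ordinal, Cardinal.lift_le, card_ord]
    exact Order.lt_succ_iff.1 (Cardinal.lt_ord.1 hβ)
  obtain ⟨f⟩ := hle
  classical
  refine ⟨fun α ↦ if h : α < β then (f ⟨α, h⟩).1 else 0, fun x hx y hy hxy ↦ ?_, fun α hα ↦ ?_⟩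
  · simp only [mem_Iio] at hx hy
    simp only [hx, hy, dite_true] at hxy
    exact Subtype.ext_iff.1 (f.injective (Subtype.ext hxy))
  · simp only [hα, dite_true]
    exact (f ⟨α, hα⟩).2

/-- Cofinally many levels of the filtration of `δ` cohere with the filtrations of the elements of
that level. -/
theorem exists_coherent_level {mu : Cardinal.{u}} (hmu : mu.IsRegular) (hunc : ℵ₀ < mu)
    {g : Ordinal.{u} → Ordinal.{u} → Ordinal.{u}} {δ i₀ : Ordinal.{u}}
    (hinj : ∀ β ≤ δ, InjOn (g β) (Iio β)) (hlt : ∀ β ≤ δ, ∀ α < β, g β α < mu.ord)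
    (hi₀ : i₀ < mu.ord) :
    ∃ i < mu.ord, i₀ < i ∧ ∀ b ∈ piece g δ i, ∀ y < b, y ∈ piece g δ i ↔ y ∈ piece g b i := by
  have hcof : mu.ord.cof = mu := hmu.cof_ord
  have hreg : (Cardinal.lift.{u + 1} mu).IsRegular := hmu.lift
  -- `R v w` says that, over the elements of level `v`, membership in level `v` for one of `g δ`, `g
  -- β` gives membership in level `w` for the other. A level closed under this is coherent.
  let R : Ordinal.{u} → Ordinal.{u} → Prop := fun v w ↦ ∀ β ∈ piece g δ v, ∀ α < β,
    (g δ α < v → g β α < w) ∧ (g β α < v → g δ α < w)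
  have hR : ∀ v < mu.ord, ∃ w < mu.ord, v < w ∧ R v w := by
    intro v hv
    obtain ⟨w, hw, hb⟩ := exists_bound (o := mu.ord)
      (X := ⋃ β ∈ piece g δ v, (g β '' (piece g δ v ∩ Iio β) ∪ g δ '' piece g β v)) (by
        rw [hcof]
        refine (card_biUnion_lt_iff_forall_of_isRegular hreg
          (mk_piece_lt (hinj δ le_rfl) hv)).2 fun β hβ ↦ ?_
        refine (mk_union_le _ _).trans_lt (Cardinal.add_lt_of_lt hreg.aleph0_le ?_ ?_)
        · exact (mk_image_le.trans (mk_le_mk_of_subset inter_subset_left)).trans_lt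
            (mk_piece_lt (hinj δ le_rfl) hv)
        · exact mk_image_le.trans_lt (mk_piece_lt (hinj β hβ.1.le) hv)) (by
        simp only [mem_iUnion]
        rintro _ ⟨β, hβ, ⟨α, hα, rfl⟩ | ⟨α, hα, rfl⟩⟩
        · exact hlt β hβ.1.le α hα.2
        · exact hlt δ le_rfl α (hα.1.trans hβ.1))
    have hlim := isSuccLimit_ord hmu.aleph0_le
    refine ⟨max (v + 1) w, max_lt (hlim.add_one_lt hv) hw,
      (lt_add_one v).trans_le (le_max_left _ _), fun β hβ α hα ↦ ⟨fun h ↦ ?_, fun h ↦ ?_⟩⟩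
    · exact (hb _ (mem_biUnion hβ (Or.inl ⟨α, ⟨⟨hα.trans hβ.1, h⟩, hα⟩, rfl⟩))).trans_le
        (le_max_right _ _)
    · exact (hb _ (mem_biUnion hβ (Or.inr ⟨α, ⟨hα, h⟩, rfl⟩))).trans_le (le_max_right _ _)
  obtain ⟨i, hi, hi₀i, h⟩ := exists_closed_under (by rwa [hcof]) hR hi₀
  refine ⟨i, hi, hi₀i, fun b hb y hy ↦ ?_⟩
  have hyδ : y < δ := hy.trans hb.1
  constructor
  · rintro ⟨-, hyi⟩
    obtain ⟨v, w, hzv, -, hwi, hR⟩ := h _ (max_lt hb.2 hyi)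
    exact ⟨hy, ((hR b ⟨hb.1, (le_max_left _ _).trans_lt hzv⟩ y hy).1
      ((le_max_right _ _).trans_lt hzv)).trans hwi⟩
  · rintro ⟨-, hyi⟩
    obtain ⟨v, w, hzv, -, hwi, hR⟩ := h _ (max_lt hb.2 hyi)
    exact ⟨hyδ, ((hR b ⟨hb.1, (le_max_left _ _).trans_lt hzv⟩ y hy).2
      ((le_max_right _ _).trans_lt hzv)).trans hwi⟩

/-- Below the successor of a regular cardinal `mu`, all the ordinals of a fixed uncountable
cofinality below `mu` are approachable. -/
theorem exists_approachable_succ {mu kap : Cardinal.{u}} (hmu : mu.IsRegular)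
    (hkap : kap.IsRegular) (hunc : ℵ₀ < kap) (hlt : kap < mu) :
    ∃ Q, Approachable (Order.succ mu) kap Q := by
  have hlam : (Order.succ mu).IsRegular := isRegular_succ hmu.aleph0_le
  have hlam' : ℵ₀ ≤ Cardinal.lift.{u + 1} (Order.succ mu) := hlam.lift.aleph0_le
  obtain ⟨g, hg⟩ := exists_filtration mu
  choose! c hc using fun (ε : Ordinal.{u}) (h : ε.cof = kap) ↦ GuessingClubs.exists_ladder hunc h
  let Q : Ordinal.{u} → Set (Set Ordinal.{u}) := fun β ↦
    {B | ∃ b ∈ Iio β, ∃ i ∈ Iio mu.ord, ∃ ε ∈ Iio mu.ord,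
      B = pullback (piece g b i) (c ε) ∩ Iic b} ∪ {∅}
  refine ⟨Q, fun β hβ ↦ ?_, fun E hE ↦ ?_⟩
  · have hmu' : #(Iio mu.ord) < Cardinal.lift.{u + 1} (Order.succ mu) := by
      rw [Cardinal.mk_Iio_ordinal, Cardinal.lift_lt, card_ord]
      exact Order.lt_succ mu
    refine (mk_union_le _ _).trans_lt (Cardinal.add_lt_of_lt hlam'
      (mk_image3_lt hlam' ?_ hmu' hmu' _) ?_)
    · rw [Cardinal.mk_Iio_ordinal, Cardinal.lift_lt]
      exact Cardinal.lt_ord.1 hβ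
    · rw [mk_singleton]
      exact one_lt_aleph0.trans_le hlam'
  · obtain ⟨δ, hδE, hδ⟩ := hE.exists_cof_eq hlam hkap (hlt.trans (Order.lt_succ mu))
    have hδlam := hE.lt δ hδE
    have hgδ : ∀ β ≤ δ, InjOn (g β) (Iio β) ∧ ∀ α < β, g β α < mu.ord :=
      fun β hβ ↦ hg β (hβ.trans_lt hδlam)
    obtain ⟨e, he⟩ := GuessingClubs.exists_ladder hunc hδ
    -- As κ < μ, a whole ladder of `δ` fits below one level, so later levels are unbounded in `δ`.
    obtain ⟨i₀, hi₀, hb⟩ := exists_bound (o := mu.ord) (X := g δ '' e) (by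
        rw [hmu.cof_ord]
        refine mk_image_le.trans_lt ?_
        rwa [he.mk_eq, Cardinal.lift_lt]) (by
        rintro _ ⟨α, hα, rfl⟩
        exact (hgδ δ le_rfl).2 α (he.lt α hα))
    obtain ⟨i, hi, hi₀i, hcoh⟩ := exists_coherent_level hmu (hunc.trans hlt)
      (fun β hβ ↦ (hgδ β hβ).1) (fun β hβ ↦ (hgδ β hβ).2) hi₀
    let a := piece g δ i
    have hub : ∀ y < δ, ∃ z ∈ a, y < z := fun y hy ↦ by
      obtain ⟨z, hz, hyz⟩ := he.unbdd y hy
      exact ⟨z, ⟨he.lt z hz, (hb _ ⟨z, hz, rfl⟩).trans hi₀i⟩, hyz⟩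
    have hε : collapse a δ < mu.ord := collapse_lt_ord
      ((mk_le_mk_of_subset inter_subset_left).trans_lt (mk_piece_lt (hgδ δ le_rfl).1 hi))
    have hcε : Ladder kap (collapse a δ) (c (collapse a δ)) :=
      hc _ ((cof_collapse (fun y hy ↦ hy.1) hub).trans hδ)
    refine ⟨δ, hδE, _, hcε.pullback hδ fun y hy ↦ ?_, fun β hβ ↦ ?_⟩
    · obtain ⟨z, hz, hyz⟩ := hub y hy
      exact ⟨z, hz, hyz, hz.1⟩
    · obtain ⟨hβA, hβl⟩ := mem_nacc_iff.1 hβ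
      rcases eq_or_ne β 0 with rfl | hβ0
      · refine Or.inr ?_
        rw [mem_singleton_iff, eq_empty_iff_forall_notMem]
        exact fun x hx ↦ not_lt_zero (mem_Iio.1 hx.1)
      · have : ∃ y < β, ∀ z ∈ pullback a (c (collapse a δ)), y < z → β ≤ z := by
          by_contra! hcon
          exact hβl ⟨hβ0, hcon⟩
        obtain ⟨y, hyβ, hy⟩ := this
        -- Minimality of `β` in the pullback yields `b ∈ a` with `y ≤ b < β`. The pullback has no
        -- point in `(y, β)`, so its segment at `β` is its part up to `b`, which coherence computes
        -- from `g b` alone.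
        obtain ⟨b, hba, hbβ, hyb⟩ := exists_of_lt_collapse (hβA.2 y hyβ)
        have hyb' : y ≤ b := not_lt.1 fun h ↦ hyb.not_gt (collapse_lt hba h)
        refine Or.inl ⟨b, hbβ, i, hi, _, hε, ?_⟩
        rw [← pullback_inter_congr (hcoh b hba)]
        ext z
        constructor
        · rintro ⟨hzβ, hz⟩
          exact ⟨hz, (not_lt.1 fun h ↦ (mem_Iio.1 hzβ).not_ge (hy z hz h)).trans hyb'⟩
        · rintro ⟨hz, hzb⟩
          exact ⟨lt_of_le_of_lt hzb hbβ, hz⟩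

/-! ### Approachability with a regular cardinal in between. -/

theorem LimPt.isSuccLimit {A : Set Ordinal.{u}} {x : Ordinal.{u}} (h : LimPt A x) :
    Order.IsSuccLimit x :=
  (accPt_principal_iff_limPt.2 h).isSuccLimit

/-- Here no coherence is needed, so dropping applies on θ to arbitrary ladders at all points of
cofinality κ. -/
theorem exists_guessing_ladders {theta kap : Cardinal.{u}} (htheta : theta.IsRegular)
    (hkap : kap.IsRegular) (hunc : ℵ₀ < kap) (hlt : Order.succ kap < theta) :
    ∃ (J : Set Ordinal.{u}) (C : Ordinal.{u} → Set Ordinal.{u}),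
      (∀ j ∈ J, j < theta.ord ∧ Ladder kap j (C j)) ∧
      ∀ E, Club theta.ord E → ∃ j ∈ J, C j ⊆ E := by
  choose! A hA using fun (ε : Ordinal.{u}) (h : ε.cof = kap) ↦ exists_ladder hunc h
  obtain ⟨E, hE, -, hguess⟩ := exists_club_drop_guess htheta hkap.aleph0_le hlt
    (S := {δ | δ < theta.ord ∧ δ.cof = kap}) (A := A) (fun E hE ↦ by
      obtain ⟨δ, hδ, hcof⟩ := hE.exists_cof_eq htheta hkap ((Order.lt_succ kap).trans hlt)
      exact ⟨δ, ⟨hE.lt δ hδ, hcof⟩, hδ⟩) fun δ hδ ↦ hA δ hδ.2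
  refine ⟨{δ | δ < theta.ord ∧ δ.cof = kap ∧ LimPt E δ}, fun δ ↦ drop E (A δ),
    fun j hj ↦ ⟨hj.1, (hA j hj.2.1).drop hE hj.1 hj.2.2⟩, fun E' hE' ↦ ?_⟩
  obtain ⟨δ, hδ, hl, -, hsub⟩ := hguess E' hE'
  exact ⟨δ, ⟨hδ.1, hδ.2, hl⟩, hsub⟩

/-- A continuous increasing sequence cofinal in `δ` agrees with the enumeration of a ladder at `δ`
on a club of indices. -/
theorem Ladder.club_agree {theta : Cardinal.{u}} (htheta : theta.IsRegular) (hunc : ℵ₀ < theta)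
    {δ : Ordinal.{u}} {e : Set Ordinal.{u}} (he : Ladder theta δ e) {ξ : Ordinal.{u} → Ordinal.{u}}
    (hmono : ∀ i < theta.ord, ∀ k < i, ξ k < ξ i) (hlt : ∀ i < theta.ord, ξ i < δ)
    (hcont : ∀ i < theta.ord, Order.IsSuccLimit i → ∀ y < ξ i, ∃ k < i, y < ξ k)
    (hcof : ∀ y < δ, ∃ i < theta.ord, y < ξ i) :
    Club theta.ord {i | i < theta.ord ∧ collapse e (ξ i) = i ∧
      ∀ γ < ξ i, collapse e γ < i} := by
  refine ⟨fun i hi ↦ hi.1, fun i hi hl ↦ ?_, fun x hx ↦ ?_⟩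
  · have hmin : ∀ γ < ξ i, collapse e γ < i := fun γ hγ ↦ by
      obtain ⟨k, hk, hγk⟩ := hcont i hi hl.isSuccLimit γ hγ
      obtain ⟨a, ha, hka, hai⟩ := hl.2 k hk
      exact (ha.2.2 γ (hγk.trans (hmono a ha.1 k hka))).trans hai
    refine ⟨hi, (collapse_le fun y _ hy ↦ hmin y hy).antisymm (not_lt.1 fun h ↦ ?_), hmin⟩
    obtain ⟨a, ha, hca, hai⟩ := hl.2 _ h
    refine hca.not_ge ?_
    rw [← ha.2.1]
    exact collapse_mono (hmono i hi a hai).le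
  · have hlim := isSuccLimit_ord htheta.aleph0_le
    have hle : theta.ord ≤ collapse e δ := by
      have h := ord_cof_le (collapse e δ)
      rwa [cof_collapse he.lt he.unbdd, he.cof] at h
    -- Closing off under both inequalities produces an index `i` at which the collapse of `e` at `ξ
    -- i` is exactly `i`.
    obtain ⟨i, hi, hxi, h⟩ := exists_closed_under (o := theta.ord) (by rwa [htheta.cof_ord])
      (R := fun v w ↦ collapse e (ξ v) < w ∧ v < collapse e (ξ w)) (by
        intro v hv
        obtain ⟨y, hy, hyδ, hvy⟩ := exists_collapse_eq (hv.trans_le hle)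
        obtain ⟨i, hi, hyi⟩ := hcof y hyδ
        have hsm : collapse e (ξ v) < theta.ord := collapse_lt_ord (he.small _ (hlt v hv))
        have hw : max (max (v + 1) (collapse e (ξ v) + 1)) i < theta.ord :=
          max_lt (max_lt (hlim.add_one_lt hv) (hlim.add_one_lt hsm)) hi
        refine ⟨_, hw, (lt_add_one v).trans_le ((le_max_left _ _).trans (le_max_left _ _)),
          (lt_add_one _).trans_le ((le_max_right _ _).trans (le_max_left _ _)), ?_⟩
        calc v = collapse e y := hvy.symm
          _ < collapse e (ξ i) := collapse_lt hy hyi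
          _ ≤ _ := collapse_mono ?_
        rcases (le_max_right (max (v + 1) (collapse e (ξ v) + 1)) i).eq_or_lt with h | h
        · exact (congrArg ξ h).le
        · exact (hmono _ hw i h).le) hx
    have hil : Order.IsSuccLimit i := LimPt.isSuccLimit (A := univ)
      ⟨(bot_lt_of_lt hxi).ne', fun z hz ↦ by
        obtain ⟨v, w, hzv, hvw, hwi, -⟩ := h z hz
        exact ⟨v, mem_univ v, hzv, hvw.trans hwi⟩⟩
    have hmin : ∀ γ < ξ i, collapse e γ < i := fun γ hγ ↦ by
      obtain ⟨k, hk, hγk⟩ := hcont i hi hil γ hγ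
      obtain ⟨v, w, hkv, hvw, hwi, hR⟩ := h k hk
      exact ((collapse_mono (hγk.trans (hmono v ((hvw.trans hwi).trans hi) k hkv)).le).trans_lt
        hR.1).trans hwi
    refine ⟨i, ⟨hi, (collapse_le fun y _ hy ↦ hmin y hy).antisymm (not_lt.1 fun hc ↦ ?_), hmin⟩,
      hxi⟩
    obtain ⟨v, w, hzv, hvw, hwi, hR⟩ := h _ hc
    exact (hzv.trans hR.2).not_ge (collapse_mono (hmono i hi w hwi).le)

theorem limPt_image {ξ : Ordinal.{u} → Ordinal.{u}} {i : Ordinal.{u}} {C : Set Ordinal.{u}}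
    (hmono : ∀ k ≤ i, ∀ m < k, ξ m < ξ k)
    (hcont : Order.IsSuccLimit i → ∀ y < ξ i, ∃ k < i, y < ξ k) (h : LimPt C i) :
    LimPt (ξ '' C) (ξ i) := by
  refine ⟨(bot_lt_of_lt (hmono i le_rfl 0 (pos_iff_ne_zero.2 h.1))).ne', fun y hy ↦ ?_⟩
  obtain ⟨k, hk, hyk⟩ := hcont h.isSuccLimit y hy
  obtain ⟨c, hc, hkc, hci⟩ := h.2 k hk
  exact ⟨_, ⟨c, hc, rfl⟩, hyk.trans (hmono c hci.le k hkc), hmono i le_rfl c hci⟩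

/-- The image of a ladder under a continuous increasing function is a ladder. -/
theorem Ladder.image {kap : Cardinal.{u}} {j : Ordinal.{u}} {C : Set Ordinal.{u}}
    (hkap : ℵ₀ ≤ kap) (hC : Ladder kap j C) {ξ : Ordinal.{u} → Ordinal.{u}}
    (hmono : ∀ i ≤ j, ∀ k < i, ξ k < ξ i)
    (hcont : ∀ i ≤ j, Order.IsSuccLimit i → ∀ y < ξ i, ∃ k < i, y < ξ k) :
    Ladder kap (ξ j) (ξ '' C) := by
  have hj : Order.IsSuccLimit j := by
    rw [← one_lt_cof_iff, hC.cof]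
    exact one_lt_aleph0.trans_le hkap
  have hcj := hcont j le_rfl hj
  refine ⟨?_, ?_, fun y hy ↦ ?_, fun x hx hl ↦ ?_, fun β hβ ↦ ?_⟩
  · rw [cof_apply_of_continuous (fun i hi ↦ hmono i hi.le) (hmono j le_rfl) hcj, hC.cof]
  · rintro _ ⟨c, hc, rfl⟩
    exact hmono j le_rfl c (hC.lt c hc)
  · obtain ⟨k, hk, hyk⟩ := hcj y hy
    obtain ⟨c, hc, hkc⟩ := hC.unbdd k hk
    exact ⟨_, ⟨c, hc, rfl⟩, hyk.trans (hmono c (hC.lt c hc).le k hkc)⟩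
  · obtain ⟨k, hk, hxk⟩ := hcj x hx
    -- This least `i` is a limit of `C`, and continuity then forces `ξ i = x`.
    obtain ⟨i, hxi, hmin⟩ := WellFounded.has_min (wellFounded_lt (α := Ordinal.{u}))
      {i | x ≤ ξ i} ⟨k, hxk.le⟩
    have hij : i < j := (not_lt.1 (hmin k hxk.le)).trans_lt hk
    have hlt : ∀ m < i, ξ m < x := fun m hm ↦ not_le.1 fun h ↦ hmin m h hm
    have hci : ∀ c ∈ C, ξ c < x → c < i := fun c hc hcx ↦ not_le.1 fun h ↦ by
      rcases h.eq_or_lt with rfl | h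
      · exact hcx.not_ge hxi
      · exact (hcx.trans_le hxi).not_gt (hmono c (hC.lt c hc).le i h)
    have hli : LimPt C i := by
      refine ⟨?_, fun m hm ↦ ?_⟩
      · obtain ⟨_, ⟨c, hc, rfl⟩, -, hcx⟩ := hl.2 0 (pos_iff_ne_zero.2 hl.1)
        exact (bot_lt_of_lt (hci c hc hcx)).ne'
      · obtain ⟨_, ⟨c, hc, rfl⟩, hmc, hcx⟩ := hl.2 _ (hlt m hm)
        refine ⟨c, hc, not_le.1 fun h ↦ ?_, hci c hc hcx⟩
        rcases h.eq_or_lt with rfl | h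
        · exact hmc.false
        · exact hmc.not_gt (hmono m (hm.le.trans hij.le) c h)
    refine ⟨i, hC.closed i hij hli, le_antisymm (not_lt.1 fun h ↦ ?_) hxi⟩
    obtain ⟨m, hm, hxm⟩ := hcont i hij.le hli.isSuccLimit x h
    exact hxm.not_gt (hlt m hm)
  · obtain ⟨k, hk, hβk⟩ := hcj β hβ
    refine lt_of_le_of_lt ?_ (hC.small k hk)
    refine (mk_le_mk_of_subset ?_).trans (mk_image_le (f := ξ))
    rintro _ ⟨⟨c, hc, rfl⟩, hcβ⟩
    refine ⟨c, ⟨hc, mem_Iio.2 (not_le.1 fun h ↦ ?_)⟩, rfl⟩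
    have hcβ' : ξ c < ξ k := lt_trans hcβ hβk
    rcases h.eq_or_lt with rfl | h
    · exact hcβ'.false
    · exact hcβ'.not_gt (hmono c (hC.lt c hc).le k h)

/-- If there is a regular cardinal strictly between `succ kap` and `lam`, then there are
stationarily many approachable ordinals of cofinality `kap` below `lam`. -/
theorem exists_approachable_of_between {lam theta kap : Cardinal.{u}} (hlam : lam.IsRegular)
    (htheta : theta.IsRegular) (hkap : kap.IsRegular) (hunc : ℵ₀ < kap)
    (hlt : Order.succ kap < theta) (hltlam : theta < lam) :
    ∃ Q, Approachable lam kap Q := by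
  have hkt : kap < theta := (Order.lt_succ kap).trans hlt
  have hlam' : ℵ₀ ≤ Cardinal.lift.{u + 1} lam := hlam.lift.aleph0_le
  have hlim : Order.IsSuccLimit lam.ord := isSuccLimit_ord hlam.aleph0_le
  have htl : theta.ord < lam.ord := ord_lt_ord.2 hltlam
  have hmkt : #(Iio theta.ord) < Cardinal.lift.{u + 1} lam := by
    rwa [Cardinal.mk_Iio_ordinal, Cardinal.lift_lt, card_ord]
  obtain ⟨J, C, hJ, hguess⟩ := exists_guessing_ladders htheta hkap hunc hlt
  choose! e he using fun (ε : Ordinal.{u}) (h : ε.cof = theta) ↦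
    exists_ladder (hunc.trans hkt) h
  let Q : Ordinal.{u} → Set (Set Ordinal.{u}) := fun σ ↦
    {B | ∃ δ ∈ Iio σ, ∃ j ∈ Iio theta.ord, ∃ i ∈ Iio theta.ord,
      B = pullback (e δ) (C j ∩ Iic i)} ∪ {∅}
  have hQmono : ∀ σ τ, σ ≤ τ → Q σ ⊆ Q τ := by
    rintro σ τ h B (⟨δ, hδ, hB⟩ | hB)
    · exact Or.inl ⟨δ, lt_of_lt_of_le hδ h, hB⟩
    · exact Or.inr hB
  refine ⟨Q, fun β hβ ↦ ?_, fun E hE ↦ ?_⟩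
  · refine (mk_union_le _ _).trans_lt (Cardinal.add_lt_of_lt hlam'
      (mk_image3_lt hlam' ?_ hmkt hmkt _) ?_)
    · rw [Cardinal.mk_Iio_ordinal, Cardinal.lift_lt]
      exact Cardinal.lt_ord.1 hβ
    · rw [mk_singleton]
      exact one_lt_aleph0.trans_le hlam'
  -- The first stage of `Q` listing the image of an initial segment of `C j`, or 0 if there is none.
  -- `ξ` is built to reach the supremum of these stages over `j` at every step.
  let τ : Ordinal.{u} → (Ordinal.{u} → Ordinal.{u}) → Ordinal.{u} → Ordinal.{u} := fun k s j ↦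
    sInf {σ | σ < lam.ord ∧ s '' (C j ∩ Iic k) ∈ Q σ}
  have hτ : ∀ k s j, τ k s j < lam.ord := by
    intro k s j
    rcases eq_empty_or_nonempty {σ | σ < lam.ord ∧ s '' (C j ∩ Iic k) ∈ Q σ} with h | h
    · simp only [τ, h, Ordinal.sInf_empty]
      exact hlam.ord_pos
    · exact (csInf_mem h).1
  obtain ⟨ξ, hξE, hξ, hcont⟩ := exists_continuous_seq hlam hE
    (fun k s ↦ sSup (τ k s '' Iio theta.ord)) (fun k s ↦ by
      refine sSup_lt_of_lt_cof ?_ (by rintro _ ⟨j, -, rfl⟩; exact hτ k s j)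
      rw [← lift_cof, hlam.cof_ord]
      exact mk_image_le.trans_lt hmkt) fun k s s' h ↦ by
      have : τ k s = τ k s' := funext fun j ↦ by
        simp only [τ]
        rw [image_congr fun m hm ↦ h m hm.2]
      simp only [this]
  have hmono : ∀ i ≤ theta.ord, ∀ k < i, ξ k < ξ i := fun i hi k hk ↦
    (hξ i (hi.trans_lt htl) k hk).1
  have hcont' : ∀ i ≤ theta.ord, Order.IsSuccLimit i → ∀ y < ξ i, ∃ k < i, y < ξ k :=
    fun i hi ↦ hcont i (hi.trans_lt htl)
  have htlim := isSuccLimit_ord htheta.aleph0_le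
  have hδ := he (ξ theta.ord) (by
    rw [cof_apply_of_continuous (fun i hi ↦ hmono i hi.le) (hmono _ le_rfl)
      (hcont' _ le_rfl htlim), htheta.cof_ord])
  obtain ⟨j, hj, hCj⟩ := hguess _ (hδ.club_agree htheta (hunc.trans hkt)
    (fun i hi ↦ hmono i hi.le) (hmono _ le_rfl) (fun i hi ↦ hcont' i hi.le)
    (hcont' _ le_rfl htlim))
  obtain ⟨hjt, hCl⟩ := hJ j hj
  -- On `C j` the collapse of the fixed ladder at `ξ theta.ord` inverts `ξ`. The segments are thus
  -- defined without reference to `ξ`, hence are listed in `Q`.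
  have heq : ∀ y, ξ '' (C j ∩ Iic y) = pullback (e (ξ theta.ord)) (C j ∩ Iic y) := by
    intro y
    ext γ
    constructor
    · rintro ⟨k, hk, rfl⟩
      obtain ⟨-, h1, h2⟩ := hCj hk.1
      refine ⟨by rwa [h1], fun γ' hγ' ↦ ?_⟩
      rw [h1]
      exact h2 γ' hγ'
    · rintro ⟨hk, hmin⟩
      obtain ⟨-, h1, h2⟩ := hCj hk.1
      refine ⟨_, hk, ?_⟩
      rcases lt_trichotomy γ (ξ (collapse (e (ξ theta.ord)) γ)) with h | h | h
      · exact absurd (h2 γ h) (lt_irrefl _)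
      · exact h.symm
      · have := hmin _ h
        rw [h1] at this
        exact absurd this (lt_irrefl _)
  refine ⟨ξ j, hξE j (hjt.trans htl), ξ '' C j, hCl.image hkap.aleph0_le
    (fun i hi ↦ hmono i (hi.trans hjt.le)) (fun i hi ↦ hcont' i (hi.trans hjt.le)), fun β hβ ↦ ?_⟩
  obtain ⟨⟨i, hi, rfl⟩, hnl⟩ := mem_nacc_iff.1 hβ
  have hit : i < theta.ord := (hCl.lt i hi).trans hjt
  have hlti : ∀ c ∈ C j, ξ c < ξ i → c < i := fun c hc hlt ↦ not_le.1 fun h ↦ by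
    rcases h.eq_or_lt with rfl | h
    · exact hlt.false
    · exact hlt.not_gt (hmono c ((hCl.lt c hc).trans hjt).le i h)
  rcases eq_or_ne i 0 with rfl | hi0
  · refine Or.inr ?_
    rw [mem_singleton_iff, eq_empty_iff_forall_notMem]
    rintro _ ⟨hx, ⟨c, hc, rfl⟩⟩
    exact not_lt_zero (hlti c hc hx)
  have : ∃ y < i, ∀ z ∈ C j, y < z → i ≤ z := by
    by_contra! hcon
    exact hnl (limPt_image (fun k hk ↦ hmono k (hk.trans hit.le)) (hcont' i hit.le) ⟨hi0, hcon⟩)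
  obtain ⟨y, hyi, hy⟩ := this
  have hset : Iio (ξ i) ∩ ξ '' C j = ξ '' (C j ∩ Iic y) := by
    ext x
    constructor
    · rintro ⟨hx, ⟨c, hc, rfl⟩⟩
      exact ⟨c, ⟨hc, not_lt.1 fun h ↦ (hlti c hc hx).not_ge (hy c hc h)⟩, rfl⟩
    · rintro ⟨c, ⟨hc, hcy⟩, rfl⟩
      exact ⟨hmono i hit.le c (lt_of_le_of_lt hcy hyi), c, hc, rfl⟩
  -- The segment is listed by stage `ξ theta.ord + 1`, possibly far above `ξ i`. So the first such
  -- stage exists below λ, and the growth of `ξ` puts it at or below `ξ i` because `y < i`.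
  have hne : {σ | σ < lam.ord ∧ ξ '' (C j ∩ Iic y) ∈ Q σ}.Nonempty :=
    ⟨ξ theta.ord + 1, hlim.add_one_lt (hE.lt _ (hξE _ htl)), Or.inl ⟨ξ theta.ord,
      mem_Iio.2 (lt_add_one _), j, hjt, y, hyi.trans hit, heq y⟩⟩
  rw [hset]
  refine hQmono _ _ ?_ (csInf_mem hne).2
  refine le_trans ?_ (hξ i (hit.trans htl) y hyi).2
  exact le_csSup ⟨lam.ord, by rintro _ ⟨j, -, rfl⟩; exact (hτ y ξ j).le⟩ ⟨j, hjt, rfl⟩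

end GuessingClubs


theorem mainTheorem4 (lam kap : Cardinal.{u}) (hlam : lam.IsRegular) (hkap : kap.IsRegular)
    (hunc : ℵ₀ < kap) (hlt : Order.succ kap < lam) :
    ∃ S : Set Ordinal.{u}, GuessingClubs.IsStationaryIn S lam.ord ∧
      (∀ δ ∈ S, δ.cof = kap) ∧
      ∃ P : Ordinal.{u} → Set (Set Ordinal.{u}),
        GuessingClubs.IsGuessingSystem lam kap.ord S P := by
  have hmu : (Order.succ kap).IsRegular := isRegular_succ hkap.aleph0_le
  have hQ : ∃ Q, GuessingClubs.Approachable lam kap Q := by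
    rcases (Order.succ_le_of_lt hlt).eq_or_lt with rfl | h
    · exact GuessingClubs.exists_approachable_succ hmu hkap hunc (Order.lt_succ kap)
    · exact GuessingClubs.exists_approachable_of_between hlam (isRegular_succ hmu.aleph0_le) hkap
        hunc (Order.lt_succ _) h
  obtain ⟨Q, hQ⟩ := hQ
  exact hQ.exists_isGuessingSystem hlam hkap.aleph0_le hlt
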